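/- Let $d\in\{2,3,\ldots\}$ and $R>0$. On $\mathbf R^{d+1}$ let $[\mathbf x,\mathbf y]=x_0y_0-x_1y_1-\cdots-x_dy_d$, and let $\mathbf H_R^d=\{\mathbf x:[\mathbf x,\mathbf x]=R^2,\ x_0>0\}$ be the $R$-radius hyperboloid with the Riemannian metric induced by $-[\cdot,\cdot]$, its Laplace–Beltrami operator $\Delta$ and its Riemannian volume measure $d\mathrm{vol}$. Define $\mathcal I_d:(0,\infty)\to\mathbf R$ by the convergent integral $$\mathcal I_d(\rho):=\int_\rho^\infty\frac{dx}{\sinh^{d-1}x},$$ and, for $\mathbf x\ne\mathbf x'$ in $\mathbf H_R^d$, $$\mathcal H_R^d(\mathbf x,\mathbf x'):=\frac{\Gamma(d/2)}{2\pi^{d/2}R^{d-2}}\,\mathcal I_d(\rho),\qquad \rho:=\cosh^{-1}\left(\left[\tfrac{\mathbf x}{R},\tfrac{\mathbf x'}{R}\right]\right),$$ where $\rho$ is the geodesic distance between $\mathbf x/R$ and $\mathbf x'/R$ on the unit hyperboloid. Then $\mathcal H_R^d$ is a fundamental solution of $-\Delta$ on $\mathbf H_R^d$: with either of its two arguments fixed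 at a point $\mathbf p$, it is a locally integrable function $u$ of the other one such that $$\int_{\mathbf H_R^d}(-\Delta f)\,u\;d\mathrm{vol}=f(\mathbf p)\qquad\text{for all } f\in C_c^\infty(\mathbf H_R^d).$$ Moreover, for all $\rho>0$: if $d$ is even, $$\mathcal I_d(\rho)=(-1)^{d/2-1}\frac{(d-3)!!}{(d-2)!!}\left[\log\coth\frac\rho2+\cosh\rho\sum_{k=1}^{d/2-1}\frac{(2k-2)!!\,(-1)^k}{(2k-1)!!\,\sinh^{2k}\rho}\right];$$ if $d$ is odd, $$\mathcal I_d(\rho)=(-1)^{(d-1)/2}\left[\frac{(d-3)!!}{(d-2)!!}+\left(\frac{d-3}2\right)!\sum_{k=1}^{(d-1)/2}\frac{(-1)^k\coth^{2k-1}\rho}{(2k-1)\,(k-1)!\,((d-2k-1)/2)!}\right]$$ $$=(-1)^{(d-1)/2}\frac{(d-3)!!}{(d-2)!!}\left[1+\cosh\rho\sum_{k=1}^{(d-1)/2}\frac{(2k-3)!!\,(-1)^k}{(2k-2)!!\,\sinh^{2k-1}\rho}\right];$$ and for every $d\ge2$, $$\mathcal I_d(\rho)=\frac1{(d-1)\cosh^{d-1}\rho}\,{}_2F_1\left(\frac{d-1}2,\frac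 d2;\frac{d+1}2;\frac1{\cosh^2\rho}\right)$$ $$=\frac1{(d-1)\cosh\rho\,\sinh^{d-2}\rho}\,{}_2F_1\left(\frac12,1;\frac{d+1}2;\frac1{\cosh^2\rho}\right)$$ $$=\frac{e^{-i\pi(d/2-1)}}{2^{d/2-1}\,\Gamma(d/2)\,\sinh^{d/2-1}\rho}\,Q_{d/2-1}^{d/2-1}(\cosh\rho).$$ Here $(-1)!!=0!!=1$, ${}_2F_1$ is the Gauss hypergeometric function, and $Q_\nu^\mu$ is the associated Legendre function of the second kind, for $z>1$, $$Q_\nu^\mu(z)=\frac{\sqrt\pi\,e^{i\pi\mu}\,\Gamma(\nu+\mu+1)\,(z^2-1)^{\mu/2}}{2^{\nu+1}\,\Gamma(\nu+\frac32)\,z^{\nu+\mu+1}}\,{}_2F_1\left(\frac{\nu+\mu+2}2,\frac{\nu+\mu+1}2;\nu+\frac32;\frac1{z^2}\right).$$ -/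

import Mathlib

open MeasureTheory
open scoped Nat ContDiff

noncomputable section

/-- The Minkowski bilinear form `x₀ y₀ - x₁ y₁ - ⋯ - x_d y_d` on `ℝ^{d,1}`. -/
def minkowski {d : ℕ} (x y : Fin (d + 1) → ℝ) : ℝ :=
  x 0 * y 0 - ∑ i : Fin d, x i.succ * y i.succ

/-- The `R`-radius hyperboloid `H_R^d`: the upper sheet of `[x, x] = R²` in Minkowski space. -/
def hyperboloid (d : ℕ) (R : ℝ) : Set (Fin (d + 1) → ℝ) :=
  {x | minkowski x x = R ^ 2 ∧ 0 < x 0}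

/-- The parametrization `ξ ↦ (√(R² + ξ₁² + ⋯ + ξ_d²), ξ₁, …, ξ_d)` of the upper sheet. -/
def hyperboloidParam {d : ℕ} (R : ℝ) (ξ : EuclideanSpace ℝ (Fin d)) : Fin (d + 1) → ℝ :=
  Fin.cons (α := fun _ => ℝ) (Real.sqrt (R ^ 2 + ∑ i, ξ i ^ 2)) (fun i => ξ i)

theorem hyperboloidParam_mem {d : ℕ} {R : ℝ} (hR : 0 < R) (ξ : EuclideanSpace ℝ (Fin d)) :
    hyperboloidParam R ξ ∈ hyperboloid d R := by
  have h : 0 < R ^ 2 + ∑ i, ξ i ^ 2 :=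
    add_pos_of_pos_of_nonneg (by positivity) (Finset.sum_nonneg fun i _ => sq_nonneg _)
  refine ⟨?_, ?_⟩
  · simp [minkowski, hyperboloidParam, Real.mul_self_sqrt h.le, ← pow_two]
  · simpa [hyperboloidParam] using h

/-- The global coordinate system `ξ = (x₁, …, x_d)` on `H_R^d`: a homeomorphism onto `ℝ^d` whose
inverse is the smooth embedding `hyperboloidParam R`. -/
def hyperboloidChart (d : ℕ) {R : ℝ} (hR : 0 < R) :
    hyperboloid d R ≃ₜ EuclideanSpace ℝ (Fin d) where
  toFun x := WithLp.toLp 2 (fun i : Fin d => x.1 i.succ)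
  invFun ξ := ⟨hyperboloidParam R ξ, hyperboloidParam_mem hR ξ⟩
  left_inv x := by
    obtain ⟨x, hx, hx0⟩ := x
    apply Subtype.ext
    funext j
    refine Fin.cases ?_ (fun i => ?_) j
    · have h : R ^ 2 + ∑ i : Fin d, x i.succ ^ 2 = x 0 ^ 2 := by
        simp only [minkowski, ← pow_two] at hx
        linarith
      simp [hyperboloidParam, h, Real.sqrt_sq hx0.le]
    · simp [hyperboloidParam]
  right_inv ξ := by
    ext i
    simp [hyperboloidParam]
  continuous_toFun :=
    (PiLp.continuous_toLp 2 _).comp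
      (continuous_pi fun i => (continuous_apply i.succ).comp continuous_subtype_val)
  continuous_invFun := by
    refine Continuous.subtype_mk (continuous_pi fun j => ?_) _
    refine Fin.cases ?_ (fun i => ?_) j
    · simp only [hyperboloidParam, Fin.cons_zero]
      fun_prop
    · simp only [hyperboloidParam, Fin.cons_succ]
      fun_prop

/-- The partial derivative `∂f/∂ξ^i` at `ξ`. -/
def partialDeriv {d : ℕ} {F : Type*} [NormedAddCommGroup F] [NormedSpace ℝ F]
    (i : Fin d) (f : EuclideanSpace ℝ (Fin d) → F) (ξ : EuclideanSpace ℝ (Fin d)) : F :=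
  fderiv ℝ f ξ (EuclideanSpace.single i 1)

/-- The Laplace-Beltrami operator of a metric `g_{ij}` in coordinates `ξ`:
`Δu = ∑_{i,j} |g|^{-1/2} ∂_i (|g|^{1/2} g^{ij} ∂_j u)`, with `|g| = |det (g_{ij})|`. -/
def laplaceBeltrami {d : ℕ} (g : EuclideanSpace ℝ (Fin d) → Matrix (Fin d) (Fin d) ℝ)
    (u : EuclideanSpace ℝ (Fin d) → ℝ) (ξ : EuclideanSpace ℝ (Fin d)) : ℝ :=
  ∑ i, ∑ j, 1 / Real.sqrt |(g ξ).det| *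
    partialDeriv i (fun η => Real.sqrt |(g η).det| * (g η)⁻¹ i j * partialDeriv j u η) ξ

/-- The metric of `H_R^d` in the coordinates `ξ`. The Minkowski form has signature `(+,-,…,-)`, so
the Riemannian (positive definite) metric which it induces on the hyperboloid is minus its
restriction to tangent vectors. -/
def hyperboloidMetric {d : ℕ} (R : ℝ) (ξ : EuclideanSpace ℝ (Fin d)) : Matrix (Fin d) (Fin d) ℝ :=
  Matrix.of fun i j =>
    -minkowski (partialDeriv i (hyperboloidParam R) ξ) (partialDeriv j (hyperboloidParam R) ξ)

/-- The Laplace-Beltrami operator on `H_R^d`, applied to a function on `H_R^d`. -/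
def hyperboloidLaplacian (d : ℕ) {R : ℝ} (hR : 0 < R) (u : hyperboloid d R → ℝ)
    (x : hyperboloid d R) : ℝ :=
  laplaceBeltrami (hyperboloidMetric R) (u ∘ (hyperboloidChart d hR).symm)
    (hyperboloidChart d hR x)

/-- The Riemannian volume measure `√|g| dξ` on `H_R^d`. -/
def hyperboloidVolume (d : ℕ) {R : ℝ} (hR : 0 < R) : Measure (hyperboloid d R) :=
  Measure.map (hyperboloidChart d hR).symm
    ((volume : Measure (EuclideanSpace ℝ (Fin d))).withDensity
      fun ξ => ENNReal.ofReal (Real.sqrt |(hyperboloidMetric R ξ).det|))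

/-- The test functions on `H_R^d`: smooth with compact support. -/
structure IsTestFunction (d : ℕ) {R : ℝ} (hR : 0 < R) (f : hyperboloid d R → ℝ) : Prop where
  smooth : ContDiff ℝ ∞ (f ∘ (hyperboloidChart d hR).symm)
  compactSupport : HasCompactSupport f

/-- `u` is locally integrable and `-Δu = δ_p` in the sense of distributions on `H_R^d`. -/
structure SolvesDirac (d : ℕ) {R : ℝ} (hR : 0 < R) (p : hyperboloid d R)
    (u : hyperboloid d R → ℝ) : Prop where
  locallyIntegrable : LocallyIntegrable u (hyperboloidVolume d hR)
  integrable : ∀ f, IsTestFunction d hR f →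
    Integrable (fun y => -hyperboloidLaplacian d hR f y * u y) (hyperboloidVolume d hR)
  integral_eq : ∀ f, IsTestFunction d hR f →
    ∫ y, -hyperboloidLaplacian d hR f y * u y ∂(hyperboloidVolume d hR) = f p

/-- `K` is a fundamental solution of `-Δ` on `H_R^d`: for each fixed value of either of its two
points, `-ΔK` is, in the other one, the Dirac distribution there. The values of `K` on the diagonal
play no role when `d ≥ 1`, since points are null sets. -/
def IsFundamentalSolution (d : ℕ) {R : ℝ} (hR : 0 < R)
    (K : hyperboloid d R → hyperboloid d R → ℝ) : Prop :=
  ∀ p, SolvesDirac d hR p (fun y => K p y) ∧ SolvesDirac d hR p (fun y => K y p)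

/-- `I_d(ρ) = ∫_ρ^∞ dx / sinh^{d-1} x`. -/
def hypIntegral (d : ℕ) (ρ : ℝ) : ℝ :=
  ∫ x in Set.Ioi ρ, 1 / Real.sinh x ^ (d - 1)

/-- The geodesic distance `ρ = cosh⁻¹ [x/R, x'/R]` of the projections of two points of `H_R^d` to
the unit hyperboloid. -/
def unitGeodesicDist {d : ℕ} {R : ℝ} (x x' : hyperboloid d R) : ℝ :=
  Real.arcosh (minkowski (R⁻¹ • x.1) (R⁻¹ • x'.1))

/-- The function `H_R^d(x, x') = Γ(d/2) / (2 π^{d/2} R^{d-2}) I_d(ρ)`. -/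
def hyperboloidGreen (d : ℕ) (R : ℝ) (x x' : hyperboloid d R) : ℝ :=
  Real.Gamma ((d : ℝ) / 2) / (2 * Real.pi ^ ((d : ℝ) / 2) * R ^ (d - 2)) *
    hypIntegral d (unitGeodesicDist x x')

/-- The associated Legendre function of the second kind `Q_ν^μ(z)` for real `z > 1`, through its
hypergeometric series in `1/z²` (`ν + μ + 1` and `ν + 3/2` not in `{0, -1, -2, …}`). -/
def legendreQ (ν μ : ℂ) (z : ℝ) : ℂ :=
  (Real.sqrt Real.pi : ℂ) * Complex.exp (Complex.I * Real.pi * μ) * Complex.Gamma (ν + μ + 1) *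
      ((z ^ 2 - 1 : ℝ) : ℂ) ^ (μ / 2) /
    ((2 : ℂ) ^ (ν + 1) * Complex.Gamma (ν + 3 / 2) * (z : ℂ) ^ (ν + μ + 1)) *
    ₂F₁ ((ν + μ + 2) / 2) ((ν + μ + 1) / 2) (ν + 3 / 2) (1 / (z : ℂ) ^ 2)

end

/-! Fundamental solution. Write `s` for the hyperbolic cosine of the distance to the pole. In the
coordinates `ξ` one computes `|grad s|² = (s² - 1) / R²` and `Δs = d s / R²`
(`sum_partialDeriv_mul_gradCoshDist`, `sum_partialDeriv_gradCoshDist`), so a function `κ(s)` with `ψ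
= κ'` satisfies `R² Δ κ(s) = (s² - 1) ψ' + d s ψ`. The choice `ψ = -(s² - 1)^(-d/2)` annihilates the
right side, and its primitive vanishing at infinity is the integral `I_d` as a function of `s`
(`hasDerivAt_greenProfile`).

The singularity is removed by multiplying `ψ`, rather than `κ`, by a smooth step `χ_n(s)`. Then only
`-χ_n' (s² - 1)^(1 - d/2)` survives (`deriv_cutoffDeriv`): up to sign a nonnegative bump shrinking
to the pole, whose mass does not depend on `n` (`integral_bump`). Green's identity against a test
function is therefore an integration by parts of smooth functions. As `n → ∞`, one side converges by
domination with the uncut Green function (`abs_cutoffProfile_le`), the other as an approximate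
identity (`tendsto_integral_mul_bump`). The mass is the area of the unit sphere times `R^(d-2)`,
which the normalizing constant inverts.

A general pole is exchanged with the origin by a volume preserving involution
(`measurePreserving_pointReflection`), so that polar coordinates are needed only at the origin.

Explicit formulas. Each reduces to `hypIntegral_eq_of_hasDerivAt`, the uniqueness of the
antiderivative vanishing at infinity. The finite sums come from a two-step reduction formula and,
for odd `d`, the substitution `t = coth x`. The hypergeometric forms come from first order
differential equations read off the power series, and the Legendre form from the duplication formula
for `Γ`. -/

namespace HyperbolicGreen

open Filter Topology Set
open scoped RealInnerProductSpace

/-! ### Elementary closed forms of the radial integral -/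

section ClosedForms

theorem tendsto_sinh_atTop : Tendsto Real.sinh atTop atTop :=
  tendsto_atTop_mono' _ ((eventually_ge_atTop 0).mono fun _ hx => Real.self_le_sinh_iff.2 hx)
    tendsto_id

theorem sinh_div_sinh_le_exp {ρ x : ℝ} (hρ : 0 < ρ) (hx : ρ ≤ x) :
    Real.sinh ρ / Real.sinh x ≤ Real.exp (ρ - x) := by
  have hx0 : 0 < Real.sinh x := Real.sinh_pos_iff.2 (hρ.trans_le hx)
  rw [div_le_iff₀ hx0, Real.sinh_eq, Real.sinh_eq]
  have h1 : Real.exp (ρ - x) * Real.exp x = Real.exp ρ := by rw [← Real.exp_add]; ring_nf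
  have h2 : Real.exp (ρ - x) * Real.exp (-x) = Real.exp (ρ - 2 * x) := by
    rw [← Real.exp_add]; ring_nf
  have h3 : Real.exp (ρ - 2 * x) ≤ Real.exp (-ρ) := Real.exp_le_exp.2 (by linarith)
  linarith

/-- The factor `e^(ρ - x)` has integral `1` over `(ρ, ∞)`. This one majorant yields both convergence
at infinity and the size estimate `hypIntegral_le`. -/
theorem one_div_sinh_pow_le {n : ℕ} (hn : 1 ≤ n) {ρ x : ℝ} (hρ : 0 < ρ) (hx : ρ ≤ x) :
    1 / Real.sinh x ^ n ≤ 1 / Real.sinh ρ ^ n * Real.exp (ρ - x) := by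
  have hx0 : 0 < Real.sinh x := Real.sinh_pos_iff.2 (hρ.trans_le hx)
  have hρ0 : 0 < Real.sinh ρ := Real.sinh_pos_iff.2 hρ
  have h1 : (Real.sinh ρ / Real.sinh x) ^ n ≤ Real.sinh ρ / Real.sinh x :=
    pow_le_of_le_one (by positivity)
      ((div_le_one hx0).2 (Real.sinh_le_sinh.2 hx)) (by omega)
  have h2 := h1.trans (sinh_div_sinh_le_exp hρ hx)
  calc 1 / Real.sinh x ^ n = 1 / Real.sinh ρ ^ n * (Real.sinh ρ / Real.sinh x) ^ n := by
        rw [div_pow]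
        field_simp
    _ ≤ _ := by gcongr

theorem integral_exp_sub_Ioi (ρ : ℝ) : ∫ x in Ioi ρ, Real.exp (ρ - x) = 1 := by
  simp_rw [sub_eq_add_neg, Real.exp_add, integral_const_mul, integral_exp_neg_Ioi,
    ← Real.exp_add]
  simp

theorem integrableOn_exp_sub_Ioi (ρ : ℝ) : IntegrableOn (fun x => Real.exp (ρ - x)) (Ioi ρ) := by
  simp_rw [sub_eq_add_neg, Real.exp_add]
  exact (integrableOn_exp_neg_Ioi ρ).const_mul _

theorem continuousOn_one_div_sinh_pow (n : ℕ) :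
    ContinuousOn (fun x => 1 / Real.sinh x ^ n) (Ioi 0) := by
  refine continuousOn_const.div (by fun_prop) fun x hx => ?_
  exact pow_ne_zero _ (Real.sinh_pos_iff.2 hx).ne'

theorem integrableOn_one_div_sinh_pow {n : ℕ} (hn : 1 ≤ n) {ρ : ℝ} (hρ : 0 < ρ) :
    IntegrableOn (fun x => 1 / Real.sinh x ^ n) (Ioi ρ) := by
  refine Integrable.mono' ((integrableOn_exp_sub_Ioi ρ).const_mul (1 / Real.sinh ρ ^ n))
    (((continuousOn_one_div_sinh_pow n).mono (Ioi_subset_Ioi hρ.le)).aestronglyMeasurable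
      measurableSet_Ioi) ?_
  refine (ae_restrict_iff' measurableSet_Ioi).2 (.of_forall fun x hx => ?_)
  have hx0 : 0 < Real.sinh x := Real.sinh_pos_iff.2 (hρ.trans hx)
  rw [Real.norm_of_nonneg (by positivity)]
  exact one_div_sinh_pow_le hn hρ (le_of_lt hx)

theorem hypIntegral_nonneg {d : ℕ} {ρ : ℝ} (hρ : 0 ≤ ρ) : 0 ≤ hypIntegral d ρ :=
  setIntegral_nonneg measurableSet_Ioi fun x hx => by
    have : 0 < Real.sinh x := Real.sinh_pos_iff.2 (hρ.trans_lt hx)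
    positivity

/-- Not sharp as `ρ → 0`, but sufficient: a singularity of order `d - 1` is still locally integrable
in dimension `d`. -/
theorem hypIntegral_le {d : ℕ} (hd : 2 ≤ d) {ρ : ℝ} (hρ : 0 < ρ) :
    hypIntegral d ρ ≤ 1 / Real.sinh ρ ^ (d - 1) := by
  calc hypIntegral d ρ ≤ ∫ x in Ioi ρ, 1 / Real.sinh ρ ^ (d - 1) * Real.exp (ρ - x) :=
        setIntegral_mono_on (integrableOn_one_div_sinh_pow (by omega) hρ)
          ((integrableOn_exp_sub_Ioi ρ).const_mul _) measurableSet_Ioi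
          fun x hx => one_div_sinh_pow_le (by omega) hρ (le_of_lt hx)
    _ = _ := by rw [integral_const_mul, integral_exp_sub_Ioi, mul_one]

/-- An antiderivative of `-1 / sinh^{d-1}` that vanishes at infinity is `hypIntegral d`. -/
theorem hypIntegral_eq_of_hasDerivAt {d : ℕ} (hd : 2 ≤ d) {F : ℝ → ℝ}
    (hF : ∀ x, 0 < x → HasDerivAt F (-(1 / Real.sinh x ^ (d - 1))) x)
    (hlim : Tendsto F atTop (𝓝 0)) {ρ : ℝ} (hρ : 0 < ρ) : hypIntegral d ρ = F ρ := by
  have := integral_Ioi_of_hasDerivAt_of_tendsto' (a := ρ)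
    (fun x hx => hF x (hρ.trans_le hx))
    (integrableOn_one_div_sinh_pow (by omega : 1 ≤ d - 1) hρ).neg hlim
  rw [integral_neg] at this
  rw [hypIntegral]
  linarith

theorem tendsto_hypIntegral {d : ℕ} (hd : 2 ≤ d) : Tendsto (hypIntegral d) atTop (𝓝 0) := by
  refine squeeze_zero' ((eventually_ge_atTop 0).mono fun ρ hρ => hypIntegral_nonneg hρ)
    ((eventually_gt_atTop 0).mono fun ρ hρ => hypIntegral_le hd hρ) ?_
  simp_rw [one_div]
  refine ((tendsto_pow_atTop (by omega)).comp ?_).inv_tendsto_atTop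
  exact tendsto_sinh_atTop

theorem hasDerivAt_hypIntegral {d : ℕ} (hd : 2 ≤ d) {ρ : ℝ} (hρ : 0 < ρ) :
    HasDerivAt (hypIntegral d) (-(1 / Real.sinh ρ ^ (d - 1))) ρ := by
  have hev : (fun x => hypIntegral d (ρ / 2) - ∫ t in (ρ / 2)..x, 1 / Real.sinh t ^ (d - 1))
      =ᶠ[𝓝 ρ] hypIntegral d := by
    filter_upwards [lt_mem_nhds (show ρ / 2 < ρ by linarith)] with x hx
    have := intervalIntegral.integral_Ioi_sub_Ioi
      (integrableOn_one_div_sinh_pow (by omega : 1 ≤ d - 1) (half_pos hρ)) hx.le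
    simp only [hypIntegral]
    linarith
  refine HasDerivAt.congr_of_eventuallyEq ?_ hev.symm
  refine HasDerivAt.const_sub _ ?_
  have hcont := continuousOn_one_div_sinh_pow (d - 1)
  refine intervalIntegral.integral_hasDerivAt_right ?_ ?_ (hcont.continuousAt (Ioi_mem_nhds hρ))
  · refine (hcont.mono fun x hx => ?_).intervalIntegrable
    rw [uIcc_of_le (by linarith)] at hx
    exact (half_pos hρ).trans_le hx.1
  · exact hcont.stronglyMeasurableAtFilter isOpen_Ioi _ hρ

/-- Replacing `cosh²` by `1 + sinh²` leaves two powers of `1 / sinh` whose exponents differ by two,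
which is the source of the reduction formula. The case `n = 0` differentiates `coth`. -/
theorem hasDerivAt_cosh_div_sinh_pow (n : ℕ) {x : ℝ} (hx : 0 < x) :
    HasDerivAt (fun x => Real.cosh x / Real.sinh x ^ (n + 1))
      (-(n * (1 / Real.sinh x ^ n) + (n + 1) * (1 / Real.sinh x ^ (n + 2)))) x := by
  have hs : Real.sinh x ≠ 0 := (Real.sinh_pos_iff.2 hx).ne'
  convert! (Real.hasDerivAt_cosh x).div ((Real.hasDerivAt_sinh x).pow (n + 1)) (pow_ne_zero _ hs)
    using 1
  have := Real.cosh_sq x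
  simp only [Nat.add_sub_cancel, Nat.cast_add, Nat.cast_one, Pi.pow_apply]
  rw [show Real.cosh x * ((n + 1 : ℝ) * Real.sinh x ^ n * Real.cosh x) =
    (n + 1 : ℝ) * Real.sinh x ^ n * Real.cosh x ^ 2 by ring, this]
  field_simp
  ring

theorem tendsto_cosh_div_sinh_pow (n : ℕ) :
    Tendsto (fun x => Real.cosh x / Real.sinh x ^ (n + 2)) atTop (𝓝 0) := by
  have h1 : Tendsto (fun x => 2 * (Real.sinh x ^ (n + 1))⁻¹) atTop (𝓝 0) := by
    simpa using ((((tendsto_pow_atTop (α := ℝ) (Nat.succ_ne_zero n)).comp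
      tendsto_sinh_atTop)).inv_tendsto_atTop).const_mul 2
  refine squeeze_zero' ?_ ?_ h1
  · filter_upwards [eventually_gt_atTop 0] with x hx
    have := Real.sinh_pos_iff.2 hx
    have := Real.cosh_pos x
    positivity
  · filter_upwards [tendsto_sinh_atTop.eventually_ge_atTop 1] with x hx
    have hc : Real.cosh x ≤ 2 * Real.sinh x := by
      have := Real.cosh_sq x
      have := Real.cosh_pos x
      nlinarith
    have h0 : 0 < Real.sinh x := by linarith
    rw [div_le_iff₀ (by positivity)]
    rw [pow_succ _ (n + 1)]
    field_simp
    exact hc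

/-- The reduction formula for `∫ dx / sinh^{d+1} x`. -/
theorem hypIntegral_add_two {d : ℕ} (hd : 2 ≤ d) {ρ : ℝ} (hρ : 0 < ρ) :
    hypIntegral (d + 2) ρ =
      (Real.cosh ρ / Real.sinh ρ ^ d - (d - 1) * hypIntegral d ρ) / d := by
  obtain ⟨n, rfl⟩ := Nat.exists_eq_add_of_le' hd
  refine hypIntegral_eq_of_hasDerivAt (by omega)
    (F := fun ρ => (Real.cosh ρ / Real.sinh ρ ^ (n + 2) -
      ((n + 2 : ℕ) - 1 : ℝ) * hypIntegral (n + 2) ρ) / (n + 2 : ℕ)) (fun x hx => ?_) ?_ hρ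
  · convert! ((hasDerivAt_cosh_div_sinh_pow (n + 1) hx).sub
      ((hasDerivAt_hypIntegral hd hx).const_mul ((n + 2 : ℕ) - 1 : ℝ))).div_const
      ((n + 2 : ℕ) : ℝ) using 1
    rw [show n + 2 + 2 - 1 = n + 1 + 2 by omega, show n + 2 - 1 = n + 1 by omega]
    push_cast
    field_simp
    ring
  · simpa using ((tendsto_cosh_div_sinh_pow n).sub
      ((tendsto_hypIntegral hd).const_mul ((n + 2 : ℕ) - 1 : ℝ))).div_const ((n + 2 : ℕ) : ℝ)

theorem tendsto_coth : Tendsto (fun x => Real.cosh x / Real.sinh x) atTop (𝓝 1) := by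
  have h : Tendsto (fun x => Real.exp (-x) / Real.sinh x + 1) atTop (𝓝 (0 + 1)) := by
    refine Tendsto.add_const 1 ?_
    simpa [div_eq_mul_inv] using
      (Real.tendsto_exp_neg_atTop_nhds_zero).mul tendsto_sinh_atTop.inv_tendsto_atTop
  rw [zero_add] at h
  refine h.congr' ?_
  filter_upwards [eventually_gt_atTop 0] with x hx
  have := (Real.sinh_pos_iff.2 hx).ne'
  field_simp
  rw [← Real.cosh_sub_sinh]
  ring

theorem hypIntegral_two {ρ : ℝ} (hρ : 0 < ρ) :
    hypIntegral 2 ρ = Real.log (Real.cosh (ρ / 2) / Real.sinh (ρ / 2)) := by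
  refine hypIntegral_eq_of_hasDerivAt le_rfl
    (F := fun ρ => Real.log (Real.cosh (ρ / 2) / Real.sinh (ρ / 2))) (fun x hx => ?_) ?_ hρ
  · have hs : Real.sinh (x / 2) ≠ 0 := (Real.sinh_pos_iff.2 (half_pos hx)).ne'
    have hc : Real.cosh (x / 2) ≠ 0 := (Real.cosh_pos _).ne'
    have h2 : HasDerivAt (fun x : ℝ => x / 2) (1 / 2) x := (hasDerivAt_id x).div_const 2
    convert! ((h2.cosh.div h2.sinh hs).log (div_ne_zero hc hs)) using 1
    have e : Real.sinh x = 2 * Real.sinh (x / 2) * Real.cosh (x / 2) := by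
      rw [← Real.sinh_two_mul]; ring_nf
    have := Real.cosh_sq (x / 2)
    simp only [Pi.div_apply]
    rw [e]
    field_simp
    rw [this]
    ring
  · have := ((tendsto_coth.comp (tendsto_id.atTop_div_const (two_pos (α := ℝ)))).log one_ne_zero)
    simpa using this

theorem hypIntegral_three {ρ : ℝ} (hρ : 0 < ρ) :
    hypIntegral 3 ρ = Real.cosh ρ / Real.sinh ρ - 1 := by
  refine hypIntegral_eq_of_hasDerivAt (by norm_num)
    (F := fun ρ => Real.cosh ρ / Real.sinh ρ - 1) (fun x hx => ?_) ?_ hρ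
  · convert! (hasDerivAt_cosh_div_sinh_pow 0 hx).sub_const 1 using 1
    · ext; simp
    · simp
  · simpa using tendsto_coth.sub_const 1

theorem hypIntegral_even (m : ℕ) {ρ : ℝ} (hρ : 0 < ρ) :
    hypIntegral (2 * m + 2) ρ =
      (-1) ^ m * (((2 * m - 1)‼ : ℝ) / ((2 * m)‼ : ℝ)) *
        (Real.log (Real.cosh (ρ / 2) / Real.sinh (ρ / 2)) +
          Real.cosh ρ * ∑ k ∈ Finset.Icc 1 m,
            ((2 * k - 2)‼ : ℝ) * (-1) ^ k / (((2 * k - 1)‼ : ℝ) * Real.sinh ρ ^ (2 * k))) := by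
  induction m with
  | zero => simp [hypIntegral_two hρ]
  | succ m ih =>
    have hs : Real.sinh ρ ≠ 0 := (Real.sinh_pos_iff.2 hρ).ne'
    rw [show 2 * (m + 1) + 2 = (2 * m + 2) + 2 by ring, hypIntegral_add_two (by omega) hρ, ih,
      Finset.sum_Icc_succ_top (by omega)]
    -- The case split is needed because `2 * m - 1` truncates to `0` at `m = 0`, where `0‼ = 1`
    -- stands in for `(-1)!!`.
    have e1 : (2 * (m + 1) - 1)‼ = (2 * m + 1) * (2 * m - 1)‼ := by
      cases m with
      | zero => simp
      | succ n =>
        rw [show 2 * (n + 1 + 1) - 1 = (2 * n + 1) + 2 by omega, Nat.doubleFactorial_add_two,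
          show 2 * (n + 1) - 1 = 2 * n + 1 by omega]
        ring
    have e2 : (2 * (m + 1))‼ = (2 * m + 2) * (2 * m)‼ := Nat.doubleFactorial_add_two _
    have h1 : ((2 * m - 1)‼ : ℝ) ≠ 0 := by exact_mod_cast (Nat.doubleFactorial_pos _).ne'
    have h2 : ((2 * m)‼ : ℝ) ≠ 0 := by exact_mod_cast (Nat.doubleFactorial_pos _).ne'
    rw [e1, e2, show 2 * (m + 1) - 2 = 2 * m by omega, show 2 * (m + 1) = 2 * m + 2 by ring]
    push_cast
    have h3 : (-1 : ℝ) ^ (m * 2) = 1 := by rw [mul_comm, pow_mul]; simp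
    have h4 : (2 * (m : ℝ) + 1) ≠ 0 := by positivity
    set S := ∑ k ∈ Finset.Icc 1 m,
      ((2 * k - 2)‼ : ℝ) * (-1) ^ k / (((2 * k - 1)‼ : ℝ) * Real.sinh ρ ^ (2 * k))
    field_simp
    ring_nf
    simp only [h3]
    ring

theorem hypIntegral_odd (m : ℕ) {ρ : ℝ} (hρ : 0 < ρ) :
    hypIntegral (2 * m + 3) ρ =
      (-1) ^ (m + 1) * (((2 * m)‼ : ℝ) / ((2 * m + 1)‼ : ℝ)) *
        (1 + Real.cosh ρ * ∑ k ∈ Finset.Icc 1 (m + 1),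
          ((2 * k - 3)‼ : ℝ) * (-1) ^ k / (((2 * k - 2)‼ : ℝ) * Real.sinh ρ ^ (2 * k - 1))) := by
  have hs : Real.sinh ρ ≠ 0 := (Real.sinh_pos_iff.2 hρ).ne'
  induction m with
  | zero =>
    simp [hypIntegral_three hρ]
    ring
  | succ m ih =>
    rw [show 2 * (m + 1) + 3 = (2 * m + 3) + 2 by ring, hypIntegral_add_two (by omega) hρ, ih,
      Finset.sum_Icc_succ_top (b := m + 1) (by omega)]
    have e1 : (2 * (m + 1) + 1)‼ = (2 * m + 3) * (2 * m + 1)‼ := Nat.doubleFactorial_add_two _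
    have e2 : (2 * (m + 1))‼ = (2 * m + 2) * (2 * m)‼ := Nat.doubleFactorial_add_two _
    have h1 : ((2 * m + 1)‼ : ℝ) ≠ 0 := by exact_mod_cast (Nat.doubleFactorial_pos _).ne'
    have h2 : ((2 * m)‼ : ℝ) ≠ 0 := by exact_mod_cast (Nat.doubleFactorial_pos _).ne'
    rw [show 2 * (m + 1 + 1) - 3 = 2 * m + 1 by omega,
      show 2 * (m + 1 + 1) - 2 = 2 * (m + 1) by omega,
      show 2 * (m + 1 + 1) - 1 = 2 * m + 3 by omega, e1, e2]
    push_cast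
    have h3 : (-1 : ℝ) ^ (m * 2) = 1 := by rw [mul_comm, pow_mul]; simp
    set S := ∑ k ∈ Finset.Icc 1 (m + 1),
      ((2 * k - 3)‼ : ℝ) * (-1) ^ k / (((2 * k - 2)‼ : ℝ) * Real.sinh ρ ^ (2 * k - 1))
    field_simp
    ring_nf
    simp only [h3]
    ring

/-- `∫₀¹ (1 - t²)^m dt = (2m)!! / (2m+1)!!`. -/
theorem integral_one_sub_sq_pow (m : ℕ) :
    ∫ t in (0 : ℝ)..1, (1 - t ^ 2) ^ m = ((2 * m)‼ : ℝ) / ((2 * m + 1)‼ : ℝ) := by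
  induction m with
  | zero => simp
  | succ m ih =>
    -- The function `t (1 - t²)^(m+1)` vanishes at both endpoints, so its derivative integrates to
    -- the recursion `(2m + 3) J_{m+1} = (2m + 2) J_m`.
    have hder : ∀ t ∈ uIcc (0 : ℝ) 1, HasDerivAt (fun t : ℝ => t * (1 - t ^ 2) ^ (m + 1))
        ((2 * m + 3) * (1 - t ^ 2) ^ (m + 1) - (2 * m + 2) * (1 - t ^ 2) ^ m) t := fun t _ => by
      convert! (hasDerivAt_id t).mul ((((hasDerivAt_id t).pow 2).const_sub 1).pow (m + 1)) using 1
      simp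
      ring
    have h := intervalIntegral.integral_eq_sub_of_hasDerivAt hder
      (Continuous.intervalIntegrable (by fun_prop) _ _)
    rw [intervalIntegral.integral_sub (Continuous.intervalIntegrable (by fun_prop) _ _)
      (Continuous.intervalIntegrable (by fun_prop) _ _), intervalIntegral.integral_const_mul,
      intervalIntegral.integral_const_mul, ih] at h
    have e1 : (2 * (m + 1) + 1)‼ = (2 * m + 3) * (2 * m + 1)‼ := Nat.doubleFactorial_add_two _
    have e2 : (2 * (m + 1))‼ = (2 * m + 2) * (2 * m)‼ := Nat.doubleFactorial_add_two _
    have h1 : ((2 * m + 1)‼ : ℝ) ≠ 0 := by exact_mod_cast (Nat.doubleFactorial_pos _).ne'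
    rw [e1, e2]
    push_cast
    simp at h
    field_simp at h ⊢
    linarith

/-- The polynomial is `-∫₀^t (1 - u²)^m du`, expanded by the binomial theorem and integrated
termwise. -/
theorem hasDerivAt_sum_odd_pow (m : ℕ) (t : ℝ) :
    HasDerivAt (fun t : ℝ => (m ! : ℝ) * ∑ k ∈ Finset.Icc 1 (m + 1),
      (-1) ^ k * t ^ (2 * k - 1) / ((2 * (k : ℝ) - 1) * ((k - 1)! : ℝ) * ((m + 1 - k)! : ℝ)))
      (-(1 - t ^ 2) ^ m) t := by
  have hre : ∀ F : ℕ → ℝ,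
      ∑ k ∈ Finset.Icc 1 (m + 1), F k = ∑ j ∈ Finset.range (m + 1), F (j + 1) := fun F => by
    rw [Finset.range_eq_Ico, Finset.sum_Ico_add' F 0 (m + 1) 1]
    rfl
  simp_rw [hre]
  have hsum : -(1 - t ^ 2) ^ m = (m ! : ℝ) * ∑ j ∈ Finset.range (m + 1),
      (-1) ^ (j + 1) * t ^ (2 * j) / ((j ! : ℝ) * ((m - j)! : ℝ)) := by
    rw [sub_eq_neg_add, add_pow, Finset.mul_sum, ← Finset.sum_neg_distrib]
    refine Finset.sum_congr rfl fun j hj => ?_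
    have hj' : j ≤ m := by simpa [Nat.lt_succ_iff] using hj
    rw [Nat.cast_choose ℝ hj', neg_pow, ← pow_mul]
    ring
  rw [hsum]
  refine HasDerivAt.const_mul _ (HasDerivAt.fun_sum fun j hj => ?_)
  have h := (((hasDerivAt_id t).pow (2 * j + 1)).const_mul ((-1 : ℝ) ^ (j + 1))).div_const
    ((2 * ((j + 1 : ℕ) : ℝ) - 1) * (j ! : ℝ) * ((m - j)! : ℝ))
  convert! h using 1
  · ext x
    simp [show 2 * (j + 1) - 1 = 2 * j + 1 by omega]
  · have h1 : (j ! : ℝ) ≠ 0 := by positivity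
    have h2 : ((m - j)! : ℝ) ≠ 0 := by positivity
    have h3 : (2 * ((j : ℝ) + 1) - 1) ≠ 0 := by
      have : (0 : ℝ) ≤ j := j.cast_nonneg
      linarith
    push_cast
    simp
    field_simp
    ring

/-- Since `coth x → 1`, the value at `1` fixes the constant that makes the antiderivative in
`hypIntegral_odd_coth` vanish at infinity. -/
theorem sum_odd_pow_one (m : ℕ) :
    (m ! : ℝ) * ∑ k ∈ Finset.Icc 1 (m + 1),
      (-1) ^ k * (1 : ℝ) ^ (2 * k - 1) / ((2 * (k : ℝ) - 1) * ((k - 1)! : ℝ) * ((m + 1 - k)! : ℝ))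
      = -(((2 * m)‼ : ℝ) / ((2 * m + 1)‼ : ℝ)) := by
  have h := intervalIntegral.integral_eq_sub_of_hasDerivAt (a := 0) (b := 1)
    (fun t _ => hasDerivAt_sum_odd_pow m t) (Continuous.intervalIntegrable (by fun_prop) _ _)
  rw [intervalIntegral.integral_neg, integral_one_sub_sq_pow] at h
  have h0 : (m ! : ℝ) * ∑ k ∈ Finset.Icc 1 (m + 1), (-1) ^ k * (0 : ℝ) ^ (2 * k - 1) /
      ((2 * (k : ℝ) - 1) * ((k - 1)! : ℝ) * ((m + 1 - k)! : ℝ)) = 0 := by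
    rw [Finset.sum_eq_zero, mul_zero]
    intro k hk
    rw [zero_pow (by have := (Finset.mem_Icc.1 hk).1; omega)]
    simp
  rw [h0, sub_zero] at h
  exact h.symm

/-- With `t = coth x`, one has `dt = -dx / sinh² x` and `1 / sinh² x = t² - 1`, so the integrand
becomes the polynomial `-(t² - 1)^m dt`. -/
theorem hypIntegral_odd_coth (m : ℕ) {ρ : ℝ} (hρ : 0 < ρ) :
    hypIntegral (2 * m + 3) ρ =
      (-1) ^ (m + 1) * (((2 * m)‼ : ℝ) / ((2 * m + 1)‼ : ℝ) +
        (m ! : ℝ) * ∑ k ∈ Finset.Icc 1 (m + 1),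
          (-1) ^ k * (Real.cosh ρ / Real.sinh ρ) ^ (2 * k - 1) /
            ((2 * (k : ℝ) - 1) * ((k - 1)! : ℝ) * ((m + 1 - k)! : ℝ))) := by
  refine hypIntegral_eq_of_hasDerivAt (by omega)
    (F := fun ρ => (-1) ^ (m + 1) * (((2 * m)‼ : ℝ) / ((2 * m + 1)‼ : ℝ) +
        (m ! : ℝ) * ∑ k ∈ Finset.Icc 1 (m + 1),
          (-1) ^ k * (Real.cosh ρ / Real.sinh ρ) ^ (2 * k - 1) /
            ((2 * (k : ℝ) - 1) * ((k - 1)! : ℝ) * ((m + 1 - k)! : ℝ)))) (fun x hx => ?_) ?_ hρ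
  · have hs : Real.sinh x ≠ 0 := (Real.sinh_pos_iff.2 hx).ne'
    have hcoth : HasDerivAt (fun x => Real.cosh x / Real.sinh x) (-(1 / Real.sinh x ^ 2)) x := by
      simpa using hasDerivAt_cosh_div_sinh_pow 0 hx
    convert! (((hasDerivAt_sum_odd_pow m (Real.cosh x / Real.sinh x)).comp x hcoth).const_add
      (((2 * m)‼ : ℝ) / ((2 * m + 1)‼ : ℝ))).const_mul ((-1 : ℝ) ^ (m + 1)) using 1
    have e : 1 - (Real.cosh x / Real.sinh x) ^ 2 = -1 * (1 / Real.sinh x ^ 2) := by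
      rw [div_pow, Real.cosh_sq]
      field_simp
      ring
    rw [e, mul_pow, show 2 * m + 3 - 1 = 2 * m + 2 by omega]
    have h3 : (-1 : ℝ) ^ (m * 2) = 1 := by rw [mul_comm, pow_mul]; simp
    field_simp
    ring_nf
    simp [h3, hs]
  · have hc := (hasDerivAt_sum_odd_pow m 1).continuousAt.tendsto.comp tendsto_coth
    rw [sum_odd_pow_one] at hc
    simpa using (hc.const_add (((2 * m)‼ : ℝ) / ((2 * m + 1)‼ : ℝ))).const_mul
      ((-1 : ℝ) ^ (m + 1))

end ClosedForms

/-! ### Hypergeometric and Legendre forms -/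

section Hypergeometric

open FormalMultilinearSeries in
-- Termwise differentiation. The derivative is recorded both through its own series and through that
-- of `z f'`, so that differential equations can be checked coefficient by coefficient.
theorem hasDerivAt_ofScalars_sum {c : ℕ → ℝ} (hr : 1 ≤ (ofScalars ℝ c).radius) {z : ℝ}
    (hz : |z| < 1) :
    HasSum (fun n => c n * z ^ n) ((ofScalars ℝ c).sum z) ∧
      ∃ f', HasSum (fun n : ℕ => (n + 1) * c (n + 1) * z ^ n) f' ∧
        HasSum (fun n : ℕ => n * c n * z ^ n) (z * f') ∧
        HasDerivAt (ofScalars ℝ c).sum f' z := by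
  have hpos : 0 < (ofScalars ℝ c).radius := lt_of_lt_of_le one_pos hr
  have hF := (ofScalars ℝ c).hasFPowerSeriesOnBall hpos
  have hmem : z ∈ Metric.eball (0 : ℝ) (ofScalars ℝ c).radius := by
    refine Metric.eball_subset_eball hr ?_
    simpa [Metric.mem_eball, edist_dist, Real.dist_eq] using hz
  constructor
  · have := hF.hasSum hmem
    simpa [ofScalars_apply_eq, mul_comm] using this
  · have h := hF.fderiv.hasSum hmem
    have h2 := (ContinuousLinearMap.apply ℝ ℝ (1 : ℝ)).hasSum h
    have h3 : HasSum (fun n : ℕ => (n + 1) * c (n + 1) * z ^ n)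
        (fderiv ℝ (ofScalars ℝ c).sum z 1) := by
      simp only [zero_add, ContinuousLinearMap.apply_apply] at h2
      convert! h2 using 1
      ext n
      simp
      ring
    refine ⟨fderiv ℝ (ofScalars ℝ c).sum z 1, h3, ?_, ?_⟩
    · have h4 : HasSum (fun n : ℕ => ((n + 1 : ℕ) : ℝ) * c (n + 1) * z ^ (n + 1))
          (z * fderiv ℝ (ofScalars ℝ c).sum z 1 -
            ∑ i ∈ Finset.range 1, (i : ℝ) * c i * z ^ i) := by
        convert! h3.mul_left z using 1
        · ext n
          push_cast
          ring
        · simp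
      exact (hasSum_nat_add_iff' (f := fun n : ℕ => (n : ℝ) * c n * z ^ n) 1).1 h4
    · have : DifferentiableAt ℝ (ofScalars ℝ c).sum z := (hF.analyticAt_of_mem hmem).differentiableAt
      exact this.hasDerivAt

theorem ordinaryHypergeometricSeries_one_le_radius {a b c : ℝ} (ha : 0 < a) (hb : 0 < b)
    (hc : 0 < c) : 1 ≤ (ordinaryHypergeometricSeries ℝ a b c).radius := by
  refine (ordinaryHypergeometricSeries_radius_eq_one ℝ a b c fun k => ?_).ge
  have : (0 : ℝ) ≤ k := k.cast_nonneg
  refine ⟨?_, ?_, ?_⟩ <;> linarith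

/-- The differential equation of `₂F₁(a, b; a + 1; ·)`. -/
theorem exists_hasDerivAt_hypergeometric_add_one {a b z : ℝ} (ha : 0 < a) (hb : 0 < b)
    (hz : |z| < 1) :
    ∃ g', HasDerivAt (₂F₁ a b (a + 1)) g' z ∧
      z * g' + a * ₂F₁ a b (a + 1) z = a * (1 - z) ^ (-b) := by
  obtain ⟨h0, g', -, hs, h2⟩ := hasDerivAt_ofScalars_sum
    (ordinaryHypergeometricSeries_one_le_radius ha hb (by linarith : 0 < a + 1)) hz
  refine ⟨g', h2, ?_⟩
  have hs2 := hs.add (h0.mul_left a)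
  have hb1 := (Real.one_div_one_sub_rpow_hasFPowerSeriesOnBall_zero b).hasSum (y := z)
    (by simpa [Metric.mem_eball, edist_dist, Real.dist_eq] using hz)
  have hz1 : 0 ≤ 1 - z := by linarith [(abs_lt.1 hz).2]
  rw [Real.rpow_neg hz1, ← one_div]
  simp only [zero_add] at hb1
  refine hs2.unique ?_
  convert! hb1.mul_left a using 1
  ext n
  rw [FormalMultilinearSeries.ofScalars_apply_eq]
  have e1 : (n ! : ℝ) * Ring.choose (b + n - 1) n = (ascPochhammer ℝ n).eval b := by
    rw [← Ring.multichoose_eq, ← nsmul_eq_mul, Ring.factorial_nsmul_multichoose_eq_ascPochhammer,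
      Polynomial.ascPochhammer_smeval_eq_eval]
  -- Both sides are the Pochhammer symbol `(a)_{n+1}`. Hence `(a)_n / (a+1)_n = a / (a + n)`, and
  -- the operator `z d/dz + a` turns the series into the binomial series.
  have e2 : (a + n) * (ascPochhammer ℝ n).eval a = a * (ascPochhammer ℝ n).eval (a + 1) := by
    rw [mul_comm, ← ascPochhammer_succ_eval, ascPochhammer_succ_left]
    simp
  have p : (ascPochhammer ℝ n).eval (a + 1) ≠ 0 := (ascPochhammer_pos n _ (by linarith)).ne'
  have hn : (n ! : ℝ) ≠ 0 := by positivity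
  have : (a + n) * ordinaryHypergeometricCoefficient a b (a + 1) n = a * Ring.choose (b + n - 1) n := by
    simp only [ordinaryHypergeometricCoefficient]
    rw [← e1]
    field_simp
    linear_combination Ring.choose (b + n - 1) n * e2
  simp only [smul_eq_mul]
  linear_combination z ^ n * this

/-- The first order differential equation of `₂F₁(1/2, 1; c; ·)`. -/
theorem exists_hasDerivAt_hypergeometric_half_one {c z : ℝ} (hc : 0 < c) (hz : |z| < 1) :
    ∃ h', HasDerivAt (₂F₁ (1 / 2 : ℝ) 1 c) h' z ∧
      z * (1 - z) * h' + (c - 1 - z / 2) * ₂F₁ (1 / 2 : ℝ) 1 c z = c - 1 := by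
  obtain ⟨h0, h', h1, hs1, h2⟩ := hasDerivAt_ofScalars_sum
    (ordinaryHypergeometricSeries_one_le_radius one_half_pos one_pos hc) hz
  refine ⟨h', h2, ?_⟩
  set e := ordinaryHypergeometricCoefficient (1 / 2 : ℝ) 1 c with he
  have e0 : e 0 = 1 := by simp [he, ordinaryHypergeometricCoefficient]
  have hs0 := (hasSum_nat_add_iff' (f := fun n : ℕ => e n * z ^ n) 1).2 h0
  -- The numerator parameter `1` cancels `n!`, so the recursion is linear in `n` on both sides and
  -- encodes a first order equation. Its inhomogeneous term comes from the coefficient `e 0 = 1`.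
  have hrec : ∀ n : ℕ, (c + n) * e (n + 1) = (1 / 2 + n) * e n := fun n => by
    have p : (ascPochhammer ℝ n).eval c ≠ 0 := (ascPochhammer_pos n _ hc).ne'
    have hn : (n ! : ℝ) ≠ 0 := by positivity
    have hcn : c + n ≠ 0 := by positivity
    simp only [he, ordinaryHypergeometricCoefficient, ascPochhammer_succ_eval, Nat.factorial_succ]
    push_cast
    field_simp
    ring
  have hL := (h1.mul_left z).add (hs0.mul_left (c - 1))
  have hR := (hs1.add (h0.mul_left (1 / 2))).mul_left z
  have := hL.unique (by
    convert! hR using 1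
    ext n
    linear_combination z ^ (n + 1) * hrec n)
  simp only [Finset.range_one, Finset.sum_singleton, e0, pow_zero] at this
  change _ = z * (z * h' + 1 / 2 * _) at this
  change z * (1 - z) * h' + (c - 1 - z / 2) * (FormalMultilinearSeries.ofScalars ℝ e).sum z = _
  linear_combination this

theorem one_div_cosh_sq_lt_one {x : ℝ} (hx : 0 < x) : |1 / Real.cosh x ^ 2| < 1 := by
  have h := Real.sinh_pos_iff.2 hx
  have hc := Real.cosh_sq x
  rw [abs_of_pos (by positivity), div_lt_one (by positivity), hc]
  nlinarith

theorem tendsto_cosh_atTop : Tendsto Real.cosh atTop atTop :=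
  tendsto_atTop_mono (fun x => (Real.sinh_lt_cosh x).le) tendsto_sinh_atTop

theorem tendsto_one_div_cosh_sq : Tendsto (fun x => 1 / Real.cosh x ^ 2) atTop (𝓝 0) := by
  simp_rw [one_div]
  exact ((tendsto_pow_atTop two_ne_zero).comp tendsto_cosh_atTop).inv_tendsto_atTop

theorem hasDerivAt_one_div_cosh_sq (x : ℝ) :
    HasDerivAt (fun x => 1 / Real.cosh x ^ 2) (-2 * Real.sinh x / Real.cosh x ^ 3) x := by
  have hc : Real.cosh x ≠ 0 := (Real.cosh_pos x).ne'
  convert! (((Real.hasDerivAt_cosh x).fun_pow 2).fun_inv (pow_ne_zero 2 hc)) using 1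
  · ext; simp
  · simp only [Nat.cast_ofNat, Nat.add_one_sub_one, pow_one]
    field_simp

theorem hypIntegral_eq_hypergeometric {d : ℕ} (hd : 2 ≤ d) {ρ : ℝ} (hρ : 0 < ρ) :
    hypIntegral d ρ = 1 / (((d : ℝ) - 1) * Real.cosh ρ ^ (d - 1)) *
      ₂F₁ (((d : ℝ) - 1) / 2) ((d : ℝ) / 2) (((d : ℝ) + 1) / 2) (1 / Real.cosh ρ ^ 2) := by
  have hd' : (2 : ℝ) ≤ d := by exact_mod_cast hd
  have ha : 0 < ((d : ℝ) - 1) / 2 := by linarith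
  rw [show ((d : ℝ) + 1) / 2 = ((d : ℝ) - 1) / 2 + 1 by ring]
  refine hypIntegral_eq_of_hasDerivAt hd (F := fun ρ => 1 / (((d : ℝ) - 1) * Real.cosh ρ ^ (d - 1)) *
      ₂F₁ (((d : ℝ) - 1) / 2) ((d : ℝ) / 2) (((d : ℝ) - 1) / 2 + 1) (1 / Real.cosh ρ ^ 2))
      (fun x hx => ?_) ?_ hρ
  · obtain ⟨g', hg, hode⟩ := exists_hasDerivAt_hypergeometric_add_one ha
      (by linarith : 0 < (d : ℝ) / 2) (one_div_cosh_sq_lt_one hx)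
    set z := 1 / Real.cosh x ^ 2 with hz
    set G := (₂F₁ (((d : ℝ) - 1) / 2) ((d : ℝ) / 2) (((d : ℝ) - 1) / 2 + 1) : ℝ → ℝ) with hG
    have hc : 0 < Real.cosh x := Real.cosh_pos x
    have hs : 0 < Real.sinh x := Real.sinh_pos_iff.2 hx
    -- Since `1 - z = tanh² x`, the source term `(1 - z)^(-d/2)` of the differential equation is
    -- `coth^d x`. The equation then eliminates `g'`, and the remaining multiples of `G` cancel
    -- against the derivative of the prefactor.
    have hz1 : 1 - z = (Real.sinh x / Real.cosh x) ^ 2 := by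
      rw [hz, div_pow, Real.sinh_sq]
      field_simp
    have hpow : (1 - z) ^ (-((d : ℝ) / 2)) = Real.cosh x ^ d / Real.sinh x ^ d := by
      rw [hz1, ← Real.rpow_natCast _ 2, ← Real.rpow_mul (by positivity),
        show ((2 : ℕ) : ℝ) * -((d : ℝ) / 2) = -(d : ℝ) by push_cast; ring,
        Real.rpow_neg (by positivity), Real.rpow_natCast, div_pow, inv_div]
    rw [hpow] at hode
    obtain ⟨n, rfl⟩ := Nat.exists_eq_add_of_le' hd
    have hd1 : ((n + 2 : ℕ) : ℝ) - 1 ≠ 0 := by linarith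
    have hw : HasDerivAt (fun x => 1 / ((((n + 2 : ℕ) : ℝ) - 1) * Real.cosh x ^ (n + 2 - 1)))
        (-(Real.sinh x / Real.cosh x ^ (n + 2))) x := by
      convert! ((((Real.hasDerivAt_cosh x).fun_pow (n + 1)).const_mul
        (((n + 2 : ℕ) : ℝ) - 1)).fun_inv (mul_ne_zero hd1 (pow_ne_zero _ hc.ne'))) using 1
      · ext; simp
      · simp only [Nat.add_sub_cancel]
        push_cast at hd1 ⊢
        field_simp
        ring
    convert! hw.mul (hg.comp x (hasDerivAt_one_div_cosh_sq x)) using 1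
    simp only [Function.comp_apply]
    rw [← hz]
    have hode' : g' = (((((n + 2 : ℕ) : ℝ) - 1) / 2) * (Real.cosh x ^ (n + 2) / Real.sinh x ^ (n + 2))
      - (((n + 2 : ℕ) : ℝ) - 1) / 2 * G z) * Real.cosh x ^ 2 := by
      rw [← hode, hz]
      field_simp
      ring
    rw [hode', show n + 2 - 1 = n + 1 by omega]
    field_simp
    ring
  · have h1 : Tendsto (fun x => 1 / (((d : ℝ) - 1) * Real.cosh x ^ (d - 1))) atTop (𝓝 0) := by
      simp_rw [one_div]
      exact (((tendsto_pow_atTop (by omega)).comp tendsto_cosh_atTop).const_mul_atTop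
        (by linarith)).inv_tendsto_atTop
    -- Differentiability at `z = 0` serves only for continuity there: the hypergeometric factor has
    -- a finite limit while the prefactor tends to `0`.
    obtain ⟨g', hg, -⟩ := exists_hasDerivAt_hypergeometric_add_one ha
      (by linarith : 0 < (d : ℝ) / 2) (show |(0 : ℝ)| < 1 by simp)
    simpa using h1.mul (hg.continuousAt.tendsto.comp tendsto_one_div_cosh_sq)

/-- Euler's transformation links this to the preceding form. The proof bypasses it, using the first
order equation of this series directly. -/
theorem hypIntegral_eq_hypergeometric_half_one {d : ℕ} (hd : 2 ≤ d) {ρ : ℝ} (hρ : 0 < ρ) :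
    hypIntegral d ρ = 1 / (((d : ℝ) - 1) * Real.cosh ρ * Real.sinh ρ ^ (d - 2)) *
      ₂F₁ (1 / 2 : ℝ) 1 (((d : ℝ) + 1) / 2) (1 / Real.cosh ρ ^ 2) := by
  have hd' : (2 : ℝ) ≤ d := by exact_mod_cast hd
  have hc0 : 0 < ((d : ℝ) + 1) / 2 := by linarith
  refine hypIntegral_eq_of_hasDerivAt hd
    (F := fun ρ => 1 / (((d : ℝ) - 1) * Real.cosh ρ * Real.sinh ρ ^ (d - 2)) *
      ₂F₁ (1 / 2 : ℝ) 1 (((d : ℝ) + 1) / 2) (1 / Real.cosh ρ ^ 2)) (fun x hx => ?_) ?_ hρ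
  · obtain ⟨g', hg, hode⟩ := exists_hasDerivAt_hypergeometric_half_one hc0
      (one_div_cosh_sq_lt_one hx)
    set z := 1 / Real.cosh x ^ 2 with hz
    set G := (₂F₁ (1 / 2 : ℝ) 1 (((d : ℝ) + 1) / 2) : ℝ → ℝ) with hG
    have hc : 0 < Real.cosh x := Real.cosh_pos x
    have hs : 0 < Real.sinh x := Real.sinh_pos_iff.2 hx
    have hcs := Real.cosh_sq x
    have hz1 : z * (1 - z) = Real.sinh x ^ 2 / Real.cosh x ^ 4 := by
      rw [hz, Real.sinh_sq]
      field_simp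
    obtain ⟨n, rfl⟩ := Nat.exists_eq_add_of_le' hd
    have hd1 : ((n + 2 : ℕ) : ℝ) - 1 ≠ 0 := by linarith
    have hw : HasDerivAt
        (fun x => 1 / ((((n + 2 : ℕ) : ℝ) - 1) * Real.cosh x * Real.sinh x ^ (n + 2 - 2)))
        (-(Real.sinh x ^ 2 + n * Real.cosh x ^ 2) /
          ((((n + 2 : ℕ) : ℝ) - 1) * Real.cosh x ^ 2 * Real.sinh x ^ (n + 1))) x := by
      -- The quotient form of the derivative avoids the exponent `n - 1`, which truncates at `n =
      -- 0`.
      have hpow : HasDerivAt (fun x => Real.sinh x ^ n)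
          (n * Real.cosh x * (Real.sinh x ^ n / Real.sinh x)) x := by
        convert! (Real.hasDerivAt_sinh x).fun_pow n using 1
        cases n with
        | zero => simp
        | succ k => simp; field_simp; ring
      convert! ((((Real.hasDerivAt_cosh x).const_mul (((n + 2 : ℕ) : ℝ) - 1)).fun_mul
        hpow).fun_inv (by positivity)) using 1
      · ext; simp
      · push_cast at hd1 ⊢
        field_simp
        ring
    convert! hw.mul (hg.comp x (hasDerivAt_one_div_cosh_sq x)) using 1
    simp only [Function.comp_apply]
    rw [← hz]
    rw [hz1] at hode
    have hode' : g' = ((((n + 2 : ℕ) : ℝ) + 1) / 2 - 1 -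
      ((((n + 2 : ℕ) : ℝ) + 1) / 2 - 1 - z / 2) * G z) * (Real.cosh x ^ 4 / Real.sinh x ^ 2) := by
      rw [show (((n + 2 : ℕ) : ℝ) + 1) / 2 - 1 -
        ((((n + 2 : ℕ) : ℝ) + 1) / 2 - 1 - z / 2) * G z =
        Real.sinh x ^ 2 / Real.cosh x ^ 4 * g' by linear_combination -hode]
      field_simp
    rw [hode', show n + 2 - 1 = n + 1 by omega, show n + 2 - 2 = n by omega, hz]
    field_simp
    push_cast
    rw [hcs]
    ring
  · have h1 : Tendsto (fun x => 1 / (((d : ℝ) - 1) * Real.cosh x * Real.sinh x ^ (d - 2)))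
        atTop (𝓝 0) := by
      have h2 : Tendsto (fun x => 1 / (((d : ℝ) - 1) * Real.cosh x)) atTop (𝓝 0) := by
        simp_rw [one_div]
        exact (tendsto_cosh_atTop.const_mul_atTop (by linarith)).inv_tendsto_atTop
      refine squeeze_zero' ?_ ?_ h2
      · filter_upwards [eventually_gt_atTop 0] with x hx
        have := Real.sinh_pos_iff.2 hx
        have := Real.cosh_pos x
        have : 0 ≤ (d : ℝ) - 1 := by linarith
        positivity
      · filter_upwards [tendsto_sinh_atTop.eventually_ge_atTop 1] with x hx
        have := Real.cosh_pos x
        have : 0 < (d : ℝ) - 1 := by linarith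
        refine one_div_le_one_div_of_le (by positivity) ?_
        exact le_mul_of_one_le_right (by positivity) (one_le_pow₀ hx)
    obtain ⟨g', hg, -⟩ := exists_hasDerivAt_hypergeometric_half_one hc0
      (show |(0 : ℝ)| < 1 by simp)
    simpa using h1.mul (hg.continuousAt.tendsto.comp tendsto_one_div_cosh_sq)

theorem ofReal_ordinaryHypergeometric (a b c x : ℝ) :
    ((₂F₁ a b c x : ℝ) : ℂ) = ₂F₁ (a : ℂ) (b : ℂ) (c : ℂ) (x : ℂ) := by
  simp only [ordinaryHypergeometric_eq_tsum, Complex.ofReal_tsum]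
  refine tsum_congr fun n => ?_
  have h : ∀ y : ℝ, (((ascPochhammer ℝ n).eval y : ℝ) : ℂ) = (ascPochhammer ℂ n).eval (y : ℂ) :=
    fun y => by
      have := Polynomial.eval_map_apply (f := Complex.ofRealHom) (p := ascPochhammer ℝ n) y
      rw [ascPochhammer_map] at this
      exact this.symm
  simp [h]

/-- For `ν = μ = d/2 - 1` the series is that of `hypIntegral_eq_hypergeometric` with its upper
parameters exchanged. The phases cancel, and the duplication formula at `d/2` matches the constants.
-/
theorem hypIntegral_eq_legendreQ {d : ℕ} (hd : 2 ≤ d) {ρ : ℝ} (hρ : 0 < ρ) :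
    (hypIntegral d ρ : ℂ) =
      Complex.exp (-(Complex.I * Real.pi * ((d : ℂ) / 2 - 1))) /
          ((2 : ℂ) ^ ((d : ℂ) / 2 - 1) * Complex.Gamma ((d : ℂ) / 2) *
            (Real.sinh ρ : ℂ) ^ ((d : ℂ) / 2 - 1)) *
        legendreQ ((d : ℂ) / 2 - 1) ((d : ℂ) / 2 - 1) (Real.cosh ρ) := by
  have hs : 0 < Real.sinh ρ := Real.sinh_pos_iff.2 hρ
  have hc : 0 < Real.cosh ρ := Real.cosh_pos ρ
  have hd' : (2 : ℝ) ≤ d := by exact_mod_cast hd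
  rw [hypIntegral_eq_hypergeometric hd hρ]
  push_cast [ofReal_ordinaryHypergeometric]
  simp only [← Complex.ofReal_cosh, ← Complex.ofReal_sinh]
  rw [legendreQ]
  have hF : ₂F₁ (((d : ℂ) / 2 - 1 + ((d : ℂ) / 2 - 1) + 2) / 2)
      (((d : ℂ) / 2 - 1 + ((d : ℂ) / 2 - 1) + 1) / 2) ((d : ℂ) / 2 - 1 + 3 / 2)
      (1 / ((Real.cosh ρ : ℝ) : ℂ) ^ 2) = ₂F₁ (((d : ℂ) - 1) / 2) ((d : ℂ) / 2) (((d : ℂ) + 1) / 2)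
      (1 / ((Real.cosh ρ : ℝ) : ℂ) ^ 2) := by
    rw [ordinaryHypergeometric, ordinaryHypergeometric, ordinaryHypergeometricSeries_symm]
    congr 2 <;> ring
  rw [hF]
  set F := ₂F₁ (((d : ℂ) - 1) / 2) ((d : ℂ) / 2) (((d : ℂ) + 1) / 2)
      (1 / ((Real.cosh ρ : ℝ) : ℂ) ^ 2)
  -- The bases are positive reals and the exponents real, so the principal complex powers descend to
  -- real powers, where `(sinh²)^(α/2) = sinh^α`.
  have hpow : (((Real.cosh ρ) ^ 2 - 1 : ℝ) : ℂ) ^ (((d : ℂ) / 2 - 1) / 2) =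
      ((Real.sinh ρ : ℝ) : ℂ) ^ ((d : ℂ) / 2 - 1) := by
    rw [← Real.sinh_sq, show ((d : ℂ) / 2 - 1) / 2 = ((((d : ℝ) / 2 - 1) / 2 : ℝ) : ℂ) by
      push_cast; ring, show (d : ℂ) / 2 - 1 = (((d : ℝ) / 2 - 1 : ℝ) : ℂ) by push_cast; ring,
      ← Complex.ofReal_cpow (by positivity), ← Complex.ofReal_cpow hs.le,
      ← Real.rpow_natCast _ 2, ← Real.rpow_mul hs.le]
    congr 2
    push_cast
    ring
  have hcosh : ((Real.cosh ρ : ℝ) : ℂ) ^ ((d : ℂ) / 2 - 1 + ((d : ℂ) / 2 - 1) + 1) =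
      ((Real.cosh ρ : ℝ) : ℂ) ^ (d - 1) := by
    rw [← Complex.cpow_natCast]
    congr 1
    rw [Nat.cast_sub (by omega)]
    push_cast
    ring
  have hexp : Complex.exp (-(Complex.I * Real.pi * ((d : ℂ) / 2 - 1))) *
      Complex.exp (Complex.I * Real.pi * ((d : ℂ) / 2 - 1)) = 1 := by
    rw [← Complex.exp_add]; simp
  have hsp : ((Real.sinh ρ : ℝ) : ℂ) ^ ((d : ℂ) / 2 - 1) ≠ 0 := by
    rw [Complex.cpow_ne_zero_iff]
    exact Or.inl (Complex.ofReal_ne_zero.2 hs.ne')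
  have hdup := Complex.Gamma_mul_Gamma_add_half ((d : ℂ) / 2)
  have hG1 : Complex.Gamma ((d : ℂ) / 2) ≠ 0 :=
    Complex.Gamma_ne_zero_of_re_pos (by simp; linarith)
  have hG2 : Complex.Gamma ((d : ℂ) / 2 + 1 / 2) ≠ 0 :=
    Complex.Gamma_ne_zero_of_re_pos (by simp; linarith)
  have hG3 : Complex.Gamma (d : ℂ) = ((d : ℂ) - 1) * Complex.Gamma ((d : ℂ) - 1) := by
    have := Complex.Gamma_add_one ((d : ℂ) - 1) (by
      rw [sub_ne_zero]; exact_mod_cast (by omega : d ≠ 1))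
    simpa using this
  have h2 : (2 : ℂ) ^ (1 - (d : ℂ)) * ((2 : ℂ) ^ ((d : ℂ) / 2 - 1) *
      (2 : ℂ) ^ ((d : ℂ) / 2 - 1 + 1)) = 1 := by
    rw [← Complex.cpow_add _ _ two_ne_zero, ← Complex.cpow_add _ _ two_ne_zero]
    ring_nf
    simp
  have h21 : (2 : ℂ) ^ ((d : ℂ) / 2 - 1) ≠ 0 := by simp
  have h22 : (2 : ℂ) ^ ((d : ℂ) / 2 - 1 + 1) ≠ 0 := by simp
  have hd1 : (d : ℂ) - 1 ≠ 0 := by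
    rw [sub_ne_zero]; exact_mod_cast (by omega : d ≠ 1)
  have hcn : ((Real.cosh ρ : ℝ) : ℂ) ^ (d - 1) ≠ 0 :=
    pow_ne_zero _ (Complex.ofReal_ne_zero.2 hc.ne')
  rw [mul_div_cancel₀ _ (two_ne_zero (α := ℂ)), hG3, Real.sqrt_eq_rpow] at hdup
  rw [hpow, hcosh, show (d : ℂ) / 2 - 1 + ((d : ℂ) / 2 - 1) + 1 = (d : ℂ) - 1 by ring,
    show (d : ℂ) / 2 - 1 + 3 / 2 = (d : ℂ) / 2 + 1 / 2 by ring, Real.sqrt_eq_rpow]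
  set P := (((Real.pi ^ (1 / 2 : ℝ) : ℝ)) : ℂ)
  set A := (2 : ℂ) ^ ((d : ℂ) / 2 - 1)
  set B := (2 : ℂ) ^ ((d : ℂ) / 2 - 1 + 1)
  set T := (2 : ℂ) ^ (1 - (d : ℂ))
  set S := ((Real.sinh ρ : ℝ) : ℂ) ^ ((d : ℂ) / 2 - 1)
  set E := Complex.exp (-(Complex.I * Real.pi * ((d : ℂ) / 2 - 1)))
  set E' := Complex.exp (Complex.I * Real.pi * ((d : ℂ) / 2 - 1))
  set C := ((Real.cosh ρ : ℝ) : ℂ) ^ (d - 1)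
  set G1 := Complex.Gamma ((d : ℂ) / 2)
  set G2 := Complex.Gamma ((d : ℂ) / 2 + 1 / 2)
  set G := Complex.Gamma ((d : ℂ) - 1)
  have key : G1 * G2 * A * B = (d - 1) * G * P := by
    linear_combination A * B * hdup + (d - 1) * G * P * h2
  field_simp
  linear_combination F * key - (d - 1) * F * P * G * hexp

end Hypergeometric

/-! ### The involution exchanging the origin with a given pole -/

section Reflection

/-- The zeroth coordinate `√(R² + |ξ|²)` of the point of the hyperboloid over `ξ`. -/
noncomputable def height (R : ℝ) {E : Type*} [NormedAddCommGroup E] (ξ : E) : ℝ :=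
  Real.sqrt (R ^ 2 + ‖ξ‖ ^ 2)

section Height

variable {E : Type*} [NormedAddCommGroup E] {R : ℝ}

theorem height_sq (ξ : E) : height R ξ ^ 2 = R ^ 2 + ‖ξ‖ ^ 2 :=
  Real.sq_sqrt (by positivity)

theorem height_pos (hR : 0 < R) (ξ : E) : 0 < height R ξ :=
  Real.sqrt_pos.2 (by positivity)

theorem le_height (ξ : E) : R ≤ height R ξ :=
  Real.le_sqrt_of_sq_le (by nlinarith [sq_nonneg ‖ξ‖])

theorem norm_le_height (ξ : E) : ‖ξ‖ ≤ height R ξ :=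
  Real.le_sqrt_of_sq_le (by nlinarith [sq_nonneg R])

theorem height_eq_iff (hR : 0 < R) (ξ : E) : height R ξ = R ↔ ξ = 0 := by
  constructor
  · intro h
    have := height_sq (R := R) ξ
    rw [h] at this
    have h2 : ‖ξ‖ ^ 2 = 0 := by linarith
    simpa using h2
  · rintro rfl
    simp [height, hR.le]

theorem continuous_height : Continuous (height R : E → ℝ) := by
  unfold height; fun_prop

end Height

section Inner

variable {E : Type*} [NormedAddCommGroup E] [InnerProductSpace ℝ E] {R : ℝ}

theorem contDiff_height (hR : 0 < R) : ContDiff ℝ ∞ (height R : E → ℝ) :=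
  ContDiff.sqrt (contDiff_const.add (contDiff_norm_sq ℝ)) fun ξ => by positivity

theorem hasFDerivAt_height (hR : 0 < R) (ξ : E) :
    HasFDerivAt (height R : E → ℝ) ((height R ξ)⁻¹ • innerSL ℝ ξ) ξ := by
  have h := ((hasStrictFDerivAt_norm_sq ξ).hasFDerivAt.const_add (R ^ 2)).sqrt
    (show R ^ 2 + ‖ξ‖ ^ 2 ≠ 0 by positivity)
  convert! h using 1
  ext v
  have := height_pos hR ξ
  simp only [height] at this ⊢
  simp
  field_simp

/-- The hyperbolic cosine of the geodesic distance, in the coordinates `ξ`. -/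
noncomputable def coshDist (R : ℝ) (P ξ : E) : ℝ :=
  (height R P * height R ξ - ⟪P, ξ⟫) / R ^ 2

/-- The isometric involution of the hyperboloid that exchanges the base point `ξ = 0` with `P`:
the point reflection in their midpoint. -/
noncomputable def pointReflection (R : ℝ) (P ξ : E) : E :=
  ((height R ξ * (height R P + R) - ⟪P, ξ⟫) / (R * (R + height R P))) • P - ξ

theorem coshDist_zero (hR : 0 < R) (ξ : E) : coshDist R 0 ξ = height R ξ / R := by
  simp only [coshDist, (height_eq_iff hR (0 : E)).2 rfl, inner_zero_left]
  field_simp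
  ring

/-- In Minkowski space the map is `x ↦ 2 [x, m] m / [m, m] - x`, with `m` the sum of the base point
and the point over `P`. It preserves the form, so the zeroth coordinate of the image, its pairing
with the base point divided by `R`, is read off from the pairing of `x` with the point over `P`. -/
theorem height_pointReflection (hR : 0 < R) (P ξ : E) :
    height R (pointReflection R P ξ) = R * coshDist R P ξ := by
  have hP := height_pos hR P
  have hξ := height_pos hR ξ
  have hP2 := height_sq (R := R) P
  have hξ2 := height_sq (R := R) ξ
  have h0 : 0 ≤ R * coshDist R P ξ := by
    have h1 : ⟪P, ξ⟫ ≤ ‖P‖ * ‖ξ‖ := real_inner_le_norm P ξ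
    have h2 : ‖P‖ * ‖ξ‖ ≤ height R P * height R ξ := by
      gcongr
      exacts [norm_le_height P, norm_le_height ξ]
    have : 0 ≤ height R P * height R ξ - ⟪P, ξ⟫ := by linarith
    unfold coshDist
    positivity
  rw [height, Real.sqrt_eq_iff_eq_sq (by positivity) h0, pointReflection, norm_sub_sq_real,
    norm_smul, mul_pow, Real.norm_eq_abs, sq_abs, inner_smul_left, coshDist]
  simp only [conj_trivial]
  rw [show ‖P‖ ^ 2 = (height R P - R) * (height R P + R) by linarith,
    show ‖ξ‖ ^ 2 = height R ξ ^ 2 - R ^ 2 by linarith]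
  have : R + height R P ≠ 0 := by positivity
  field_simp
  ring

theorem pointReflection_involutive (hR : 0 < R) (P : E) :
    Function.Involutive (pointReflection R P) := by
  intro ξ
  have hP := height_pos hR P
  have hP2 := height_sq (R := R) P
  conv_lhs => rw [pointReflection]
  rw [height_pointReflection hR]
  simp only [pointReflection, inner_sub_right, inner_smul_right, real_inner_self_eq_norm_sq,
    coshDist]
  rw [show ‖P‖ ^ 2 = (height R P - R) * (height R P + R) by linarith]
  rw [sub_sub_eq_add_sub, sub_eq_iff_eq_add, add_comm ξ, add_right_cancel_iff]
  congr 1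
  have : R + height R P ≠ 0 := by positivity
  field_simp
  ring

theorem pointReflection_zero (hR : 0 < R) (P : E) : pointReflection R P 0 = P := by
  have hP := height_pos hR P
  simp only [pointReflection, (height_eq_iff hR (0 : E)).2 rfl, inner_zero_right, sub_zero,
    add_comm R]
  rw [div_self (by positivity), one_smul]

theorem coshDist_pointReflection (hR : 0 < R) (P ξ : E) :
    coshDist R P (pointReflection R P ξ) = height R ξ / R := by
  rw [eq_div_iff hR.ne', mul_comm, ← height_pointReflection hR, pointReflection_involutive hR]

theorem one_le_coshDist (hR : 0 < R) (P ξ : E) : 1 ≤ coshDist R P ξ := by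
  have h := height_pointReflection hR P ξ
  have h2 := le_height (R := R) (pointReflection R P ξ)
  rw [h] at h2
  nlinarith

/-- In the equality case the reflected point has height `R`, hence is the origin, and reflecting
back gives `P`. -/
theorem one_lt_coshDist (hR : 0 < R) {P ξ : E} (h : ξ ≠ P) : 1 < coshDist R P ξ := by
  refine lt_of_le_of_ne (one_le_coshDist hR P ξ) fun h1 => h ?_
  have h2 := height_pointReflection hR P ξ
  rw [← h1, mul_one, height_eq_iff hR] at h2
  rw [← pointReflection_involutive hR P ξ, h2, pointReflection_zero hR]

theorem contDiff_coshDist (hR : 0 < R) (P : E) : ContDiff ℝ ∞ (coshDist R P) := by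
  have := contDiff_height (E := E) hR
  unfold coshDist
  exact ((contDiff_const.mul this).sub (contDiff_const.inner ℝ contDiff_id)).div_const _

theorem hasFDerivAt_coshDist (hR : 0 < R) (P ξ : E) :
    HasFDerivAt (coshDist R P)
      ((R ^ 2)⁻¹ • (height R P • (height R ξ)⁻¹ • innerSL ℝ ξ - innerSL ℝ P)) ξ := by
  have h := ((((hasFDerivAt_height hR ξ).const_mul (height R P)).sub
    (innerSL ℝ P).hasFDerivAt).const_mul (R ^ 2)⁻¹)
  refine h.congr_of_eventuallyEq (.of_forall fun x => ?_)
  simp [coshDist, div_eq_inv_mul]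

theorem continuous_pointReflection (P : E) : Continuous (pointReflection R P) := by
  have := continuous_height (E := E) (R := R)
  unfold pointReflection
  fun_prop

theorem hasFDerivAt_pointReflection (hR : 0 < R) (P ξ : E) :
    HasFDerivAt (pointReflection R P)
      (((R * (R + height R P))⁻¹ • ((height R P + R) • (height R ξ)⁻¹ • innerSL ℝ ξ -
        innerSL ℝ P)).smulRight P - ContinuousLinearMap.id ℝ E) ξ := by
  have h := ((((hasFDerivAt_height hR ξ).const_mul (height R P + R)).sub
    (innerSL ℝ P).hasFDerivAt).const_mul (R * (R + height R P))⁻¹).smul_const P |>.sub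
    (hasFDerivAt_id ξ)
  refine h.congr_of_eventuallyEq (.of_forall fun x => ?_)
  simp only [pointReflection, Pi.sub_apply, innerSL_apply_apply, id]
  congr 2
  ring

/-- The differential is `-1` times the rank one perturbation `v ↦ v - L(v) P` of the identity, of
determinant `1 - L(P)`. The absolute value removes the sign `(-1)^dim`. -/
theorem abs_det_fderiv_pointReflection (hR : 0 < R) [FiniteDimensional ℝ E] (P ξ : E) :
    |((((R * (R + height R P))⁻¹ • ((height R P + R) • (height R ξ)⁻¹ • innerSL ℝ ξ -
        innerSL ℝ P)).smulRight P - ContinuousLinearMap.id ℝ E : E →L[ℝ] E)).det| =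
      height R (pointReflection R P ξ) / height R ξ := by
  have hP := height_pos hR P
  have hξ := height_pos hR ξ
  have hP2 := height_sq (R := R) P
  set L : E →L[ℝ] ℝ := (R * (R + height R P))⁻¹ • ((height R P + R) • (height R ξ)⁻¹ • innerSL ℝ ξ -
        innerSL ℝ P) with hL
  have e : ((L.smulRight P - ContinuousLinearMap.id ℝ E : E →L[ℝ] E) : E →ₗ[ℝ] E) =
      (-1 : ℝ) • LinearMap.transvection (-L : E →ₗ[ℝ] ℝ) P := by
    ext v
    simp [LinearMap.transvection.apply, sub_eq_add_neg]
  have e2 : 1 + (-L : E →ₗ[ℝ] ℝ) P = height R (pointReflection R P ξ) / height R ξ := by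
    rw [height_pointReflection hR, hL]
    simp only [LinearMap.neg_apply, ContinuousLinearMap.coe_coe, smul_apply,
      sub_apply, innerSL_apply_apply, smul_eq_mul, coshDist,
      real_inner_self_eq_norm_sq]
    rw [show ‖P‖ ^ 2 = (height R P - R) * (height R P + R) by linarith, real_inner_comm P ξ]
    have : R + height R P ≠ 0 := by positivity
    field_simp
    ring
  rw [ContinuousLinearMap.det, e, LinearMap.det_smul, LinearMap.transvection.det, e2, abs_mul,
    abs_pow, abs_neg, abs_one, one_pow, one_mul, abs_of_pos]
  exact div_pos (height_pos hR _) hξ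

/-- The Riemannian volume of the hyperboloid in the coordinates `ξ`. -/
noncomputable def coordVolume (R : ℝ) (E : Type*) [NormedAddCommGroup E] [MeasureSpace E] :
    Measure E :=
  (volume : Measure E).withDensity fun ξ => ENNReal.ofReal (R / height R ξ)

theorem measurePreserving_pointReflection (hR : 0 < R) [FiniteDimensional ℝ E] [MeasurableSpace E]
    [BorelSpace E] (P : E) :
    MeasurePreserving (pointReflection R P) (coordVolume R E) (coordVolume R E) := by
  have hm : Measurable (pointReflection R P) := (continuous_pointReflection P).measurable
  refine ⟨hm, ?_⟩
  ext A hA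
  -- For an involution preimages are images, so the change of variables formula applies. The
  -- Jacobian, a quotient of heights, then cancels the quotient of the densities.
  have hpre : pointReflection R P ⁻¹' A = pointReflection R P '' A :=
    (congrFun (pointReflection_involutive hR P).image_eq_preimage_symm A).symm
  rw [Measure.map_apply hm hA, coordVolume, withDensity_apply _ (hm hA), withDensity_apply _ hA,
    hpre, lintegral_image_eq_lintegral_abs_det_fderiv_mul _ hA
      (fun ξ _ => (hasFDerivAt_pointReflection hR P ξ).hasFDerivWithinAt)
      (pointReflection_involutive hR P).injective.injOn]
  refine lintegral_congr fun ξ => ?_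
  have h1 := height_pos hR ξ
  have h2 := height_pos hR (pointReflection R P ξ)
  rw [abs_det_fderiv_pointReflection hR, ← ENNReal.ofReal_mul (by positivity)]
  congr 1
  field_simp

end Inner

end Reflection

/-! ### The Laplacian in coordinates and Green's identity -/

section GreenIdentity

variable {d : ℕ} {R : ℝ}

theorem hyperboloidParam_zero (ξ : EuclideanSpace ℝ (Fin d)) :
    hyperboloidParam R ξ 0 = height R ξ := by
  simp [hyperboloidParam, height, EuclideanSpace.real_norm_sq_eq]

theorem hyperboloidParam_succ (ξ : EuclideanSpace ℝ (Fin d)) (i : Fin d) :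
    hyperboloidParam R ξ i.succ = ξ i := by
  simp [hyperboloidParam]

theorem partialDeriv_eq {F : Type*} [NormedAddCommGroup F] [NormedSpace ℝ F]
    {f : EuclideanSpace ℝ (Fin d) → F} {f' : EuclideanSpace ℝ (Fin d) →L[ℝ] F}
    {ξ : EuclideanSpace ℝ (Fin d)} (h : HasFDerivAt f f' ξ) (i : Fin d) :
    partialDeriv i f ξ = f' (EuclideanSpace.single i 1) := by
  rw [partialDeriv, h.fderiv]

theorem inner_single_one (ξ : EuclideanSpace ℝ (Fin d)) (i : Fin d) :
    ⟪ξ, EuclideanSpace.single i (1 : ℝ)⟫ = ξ i := by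
  simp [EuclideanSpace.inner_single_right]

theorem partialDeriv_hyperboloidParam (hR : 0 < R) (ξ : EuclideanSpace ℝ (Fin d)) (i : Fin d) :
    partialDeriv i (hyperboloidParam R) ξ =
      Fin.cons (α := fun _ => ℝ) (ξ i / height R ξ) (Pi.single i 1) := by
  have h : HasFDerivAt (hyperboloidParam R)
      (ContinuousLinearMap.pi (Fin.cons (α := fun _ => EuclideanSpace ℝ (Fin d) →L[ℝ] ℝ)
        ((height R ξ)⁻¹ • innerSL ℝ ξ) fun j => EuclideanSpace.proj j)) ξ := by
    rw [hasFDerivAt_pi']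
    intro j
    refine Fin.cases ?_ (fun j => ?_) j
    · refine (hasFDerivAt_height hR ξ).congr_of_eventuallyEq (.of_forall fun x => ?_)
      exact hyperboloidParam_zero x
    · refine (EuclideanSpace.proj j : EuclideanSpace ℝ (Fin d) →L[ℝ] ℝ).hasFDerivAt
        |>.congr_of_eventuallyEq (.of_forall fun x => ?_)
      exact hyperboloidParam_succ x j
  rw [partialDeriv_eq h]
  ext j
  refine Fin.cases ?_ (fun j => ?_) j
  · simp [div_eq_inv_mul, inner_single_one]
  · simp [Pi.single_apply]

/-- The zeroth coordinate contributes a rank one term. This makes the determinant and the inverse of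
the metric explicit. -/
theorem hyperboloidMetric_eq (hR : 0 < R) (ξ : EuclideanSpace ℝ (Fin d)) :
    hyperboloidMetric R ξ = 1 - Matrix.of fun i j => ξ i * ξ j / height R ξ ^ 2 := by
  ext i j
  simp only [hyperboloidMetric, partialDeriv_hyperboloidParam hR, minkowski, Matrix.of_apply,
    Fin.cons_zero, Fin.cons_succ, Matrix.sub_apply, Matrix.one_apply]
  simp only [Pi.single_apply, mul_ite, mul_one, mul_zero, Finset.sum_ite_eq', Finset.mem_univ,
    if_true, eq_comm (a := j)]
  ring

theorem det_hyperboloidMetric (hR : 0 < R) (ξ : EuclideanSpace ℝ (Fin d)) :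
    (hyperboloidMetric R ξ).det = (R / height R ξ) ^ 2 := by
  have hh := height_pos hR ξ
  have hh2 := height_sq (R := R) ξ
  have e : hyperboloidMetric R ξ = 1 + Matrix.replicateCol Unit (fun i => -ξ i / height R ξ ^ 2) *
      Matrix.replicateRow Unit (fun i => ξ i) := by
    rw [hyperboloidMetric_eq hR]
    ext i j
    simp [Matrix.mul_apply]
    ring
  have e2 : (fun i => ξ i) ⬝ᵥ (fun i => -ξ i / height R ξ ^ 2) = -‖ξ‖ ^ 2 / height R ξ ^ 2 := by
    rw [EuclideanSpace.real_norm_sq_eq, ← Finset.sum_neg_distrib, Finset.sum_div]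
    refine Finset.sum_congr rfl fun i _ => ?_
    ring
  rw [e, Matrix.det_one_add_replicateCol_mul_replicateRow, e2, div_pow,
    show ‖ξ‖ ^ 2 = height R ξ ^ 2 - R ^ 2 by linarith]
  field_simp
  ring

theorem sqrt_abs_det_hyperboloidMetric (hR : 0 < R) (ξ : EuclideanSpace ℝ (Fin d)) :
    Real.sqrt |(hyperboloidMetric R ξ).det| = R / height R ξ := by
  have hh := height_pos hR ξ
  rw [det_hyperboloidMetric hR, abs_of_nonneg (by positivity), Real.sqrt_sq (by positivity)]

theorem inv_hyperboloidMetric (hR : 0 < R) (ξ : EuclideanSpace ℝ (Fin d)) :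
    (hyperboloidMetric R ξ)⁻¹ = 1 + Matrix.of fun i j => ξ i * ξ j / R ^ 2 := by
  have hh := height_pos hR ξ
  have hh2 := height_sq (R := R) ξ
  refine Matrix.inv_eq_right_inv ?_
  rw [hyperboloidMetric_eq hR, sub_mul, mul_add, mul_add, one_mul, one_mul, mul_one]
  ext i j
  have e : ∑ k, ξ i * ξ k / height R ξ ^ 2 * (ξ k * ξ j / R ^ 2) =
      ξ i * ξ j * ‖ξ‖ ^ 2 / (height R ξ ^ 2 * R ^ 2) := by
    rw [EuclideanSpace.real_norm_sq_eq, Finset.mul_sum, Finset.sum_div]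
    refine Finset.sum_congr rfl fun k _ => ?_
    field_simp
  simp only [Matrix.sub_apply, Matrix.add_apply, Matrix.mul_apply, Matrix.of_apply, e]
  rw [show ‖ξ‖ ^ 2 = height R ξ ^ 2 - R ^ 2 by linarith]
  field_simp
  ring

/-- The coefficients `√|g| g^{ij}` of the Dirichlet form of the hyperboloid. -/
noncomputable def dirichletCoeff (R : ℝ) (ξ : EuclideanSpace ℝ (Fin d)) (i j : Fin d) : ℝ :=
  R / height R ξ * ((if i = j then 1 else 0) + ξ i * ξ j / R ^ 2)

/-- `√|g| Δ u` in the coordinates `ξ`. -/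
noncomputable def densityLaplacian (R : ℝ) (u : EuclideanSpace ℝ (Fin d) → ℝ)
    (ξ : EuclideanSpace ℝ (Fin d)) : ℝ :=
  ∑ i, ∑ j, partialDeriv i (fun η => dirichletCoeff R η i j * partialDeriv j u η) ξ

theorem laplaceBeltrami_hyperboloidMetric (hR : 0 < R) (u : EuclideanSpace ℝ (Fin d) → ℝ)
    (ξ : EuclideanSpace ℝ (Fin d)) :
    laplaceBeltrami (hyperboloidMetric R) u ξ = height R ξ / R * densityLaplacian R u ξ := by
  simp only [laplaceBeltrami, densityLaplacian, sqrt_abs_det_hyperboloidMetric hR,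
    inv_hyperboloidMetric hR, Finset.mul_sum, dirichletCoeff, Matrix.add_apply, Matrix.one_apply,
    Matrix.of_apply, one_div_div]

theorem contDiff_coord (i : Fin d) :
    ContDiff ℝ ∞ (fun ξ : EuclideanSpace ℝ (Fin d) => ξ i) :=
  (EuclideanSpace.proj i : EuclideanSpace ℝ (Fin d) →L[ℝ] ℝ).contDiff

theorem contDiff_dirichletCoeff (hR : 0 < R) (i j : Fin d) :
    ContDiff ℝ ∞ (fun ξ : EuclideanSpace ℝ (Fin d) => dirichletCoeff R ξ i j) := by
  unfold dirichletCoeff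
  refine (contDiff_const.div (contDiff_height hR) fun ξ => (height_pos hR ξ).ne').mul ?_
  exact contDiff_const.add (((contDiff_coord i).mul (contDiff_coord j)).div_const _)

theorem contDiff_partialDeriv {m n : WithTop ℕ∞} {u : EuclideanSpace ℝ (Fin d) → ℝ}
    (hu : ContDiff ℝ n u) (hmn : m + 1 ≤ n) (i : Fin d) : ContDiff ℝ m (partialDeriv i u) :=
  (hu.fderiv_right hmn).clm_apply contDiff_const

theorem hasCompactSupport_partialDeriv {u : EuclideanSpace ℝ (Fin d) → ℝ}
    (hu : HasCompactSupport u) (i : Fin d) : HasCompactSupport (partialDeriv i u) :=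
  hu.fderiv_apply (𝕜 := ℝ) _

theorem contDiff_densityLaplacian (hR : 0 < R) {u : EuclideanSpace ℝ (Fin d) → ℝ}
    (hu : ContDiff ℝ ∞ u) : ContDiff ℝ ∞ (densityLaplacian R u) :=
  ContDiff.sum fun i _ => ContDiff.sum fun j _ => contDiff_partialDeriv (n := ∞)
    ((contDiff_dirichletCoeff hR i j).mul (contDiff_partialDeriv hu le_rfl j)) le_rfl i

theorem hasCompactSupport_finset_sum {ι X : Type*} [TopologicalSpace X] (s : Finset ι)
    {f : ι → X → ℝ} (hf : ∀ i, HasCompactSupport (f i)) :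
    HasCompactSupport (fun x => ∑ i ∈ s, f i x) := by
  classical
  induction s using Finset.induction_on with
  | empty => exact HasCompactSupport.zero
  | insert a s ha ih =>
    simp only [Finset.sum_insert ha]
    exact (hf a).add ih

theorem hasCompactSupport_densityLaplacian {u : EuclideanSpace ℝ (Fin d) → ℝ}
    (hu : HasCompactSupport u) : HasCompactSupport (densityLaplacian R u) :=
  hasCompactSupport_finset_sum _ fun i => hasCompactSupport_finset_sum _ fun j =>
    hasCompactSupport_partialDeriv (hasCompactSupport_partialDeriv hu j).mul_left i

theorem integral_partialDeriv_mul {F G : EuclideanSpace ℝ (Fin d) → ℝ} (hF : ContDiff ℝ 1 F)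
    (hFc : HasCompactSupport F) (hG : ContDiff ℝ 1 G) (i : Fin d) :
    ∫ ξ, partialDeriv i F ξ * G ξ = -∫ ξ, F ξ * partialDeriv i G ξ := by
  have hF' : Continuous (partialDeriv i F) :=
    (contDiff_partialDeriv (m := 0) hF (by simp) i).continuous
  have hG' : Continuous (partialDeriv i G) :=
    (contDiff_partialDeriv (m := 0) hG (by simp) i).continuous
  have h := integral_mul_fderiv_eq_neg_fderiv_mul_of_integrable (μ := volume) (f := F) (g := G)
    (v := EuclideanSpace.single i 1)
    ((hF'.mul hG.continuous).integrable_of_hasCompactSupport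
      (hasCompactSupport_partialDeriv hFc i).mul_right)
    ((hF.continuous.mul hG').integrable_of_hasCompactSupport hFc.mul_right)
    ((hF.continuous.mul hG.continuous).integrable_of_hasCompactSupport hFc.mul_right)
    (fun ξ _ => hF.differentiable (by simp) ξ) (fun ξ _ => hG.differentiable (by simp) ξ)
  simp only [partialDeriv] at h ⊢
  rw [h, neg_neg]

theorem partialDeriv_coshDist (hR : 0 < R) (P ξ : EuclideanSpace ℝ (Fin d)) (i : Fin d) :
    partialDeriv i (coshDist R P) ξ = (height R P / height R ξ * ξ i - P i) / R ^ 2 := by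
  rw [partialDeriv_eq (hasFDerivAt_coshDist hR P ξ)]
  simp [inner_single_one]
  ring

theorem inner_eq_sum (P ξ : EuclideanSpace ℝ (Fin d)) : ⟪P, ξ⟫ = ∑ i, P i * ξ i := by
  simp [PiLp.inner_apply, mul_comm]

/-- The coordinates of `√|g| grad s`, where `s` is `coshDist R P`. -/
noncomputable def gradCoshDist (R : ℝ) (P : EuclideanSpace ℝ (Fin d)) (j : Fin d)
    (ξ : EuclideanSpace ℝ (Fin d)) : ℝ :=
  (ξ j * coshDist R P ξ - P j) / (R * height R ξ)

theorem sum_mul_partialDeriv_coshDist (hR : 0 < R) (P ξ : EuclideanSpace ℝ (Fin d)) :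
    ∑ i, ξ i * partialDeriv i (coshDist R P) ξ = coshDist R P ξ - height R P / height R ξ := by
  have hh := height_pos hR ξ
  have hh2 := height_sq (R := R) ξ
  have : ∑ i, ξ i * partialDeriv i (coshDist R P) ξ =
      (height R P / height R ξ * ‖ξ‖ ^ 2 - ⟪P, ξ⟫) / R ^ 2 := by
    rw [EuclideanSpace.real_norm_sq_eq, inner_eq_sum, Finset.mul_sum, ← Finset.sum_sub_distrib,
      Finset.sum_div]
    refine Finset.sum_congr rfl fun i _ => ?_
    rw [partialDeriv_coshDist hR]
    ring
  rw [this, show ‖ξ‖ ^ 2 = height R ξ ^ 2 - R ^ 2 by linarith, coshDist]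
  field_simp
  ring

theorem sum_dirichletCoeff_mul_partialDeriv (hR : 0 < R) (P ξ : EuclideanSpace ℝ (Fin d))
    (j : Fin d) :
    ∑ i, dirichletCoeff R ξ i j * partialDeriv i (coshDist R P) ξ = gradCoshDist R P j ξ := by
  have hh := height_pos hR ξ
  have : ∑ i, dirichletCoeff R ξ i j * partialDeriv i (coshDist R P) ξ =
      R / height R ξ * (partialDeriv j (coshDist R P) ξ + ξ j / R ^ 2 *
        ∑ i, ξ i * partialDeriv i (coshDist R P) ξ) := by
    have h1 : partialDeriv j (coshDist R P) ξ =
        ∑ i, if i = j then partialDeriv i (coshDist R P) ξ else 0 := by simp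
    rw [h1, Finset.mul_sum (a := ξ j / R ^ 2), ← Finset.sum_add_distrib, Finset.mul_sum]
    refine Finset.sum_congr rfl fun i _ => ?_
    simp only [dirichletCoeff]
    split_ifs <;> ring
  rw [this, sum_mul_partialDeriv_coshDist hR, partialDeriv_coshDist hR, gradCoshDist]
  field_simp
  ring

theorem contDiff_gradCoshDist (hR : 0 < R) (P : EuclideanSpace ℝ (Fin d)) (j : Fin d) :
    ContDiff ℝ ∞ (gradCoshDist R P j) := by
  unfold gradCoshDist
  refine ContDiff.div ?_ (contDiff_const.mul (contDiff_height hR)) fun ξ =>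
    (mul_pos hR (height_pos hR ξ)).ne'
  exact ((contDiff_coord j).mul (contDiff_coshDist hR P)).sub contDiff_const

theorem partialDeriv_gradCoshDist (hR : 0 < R) (P ξ : EuclideanSpace ℝ (Fin d)) (j : Fin d) :
    partialDeriv j (gradCoshDist R P j) ξ =
      (coshDist R P ξ + ξ j * partialDeriv j (coshDist R P) ξ) / (R * height R ξ) -
        (ξ j * coshDist R P ξ - P j) * ξ j / (R * height R ξ ^ 3) := by
  have hh := height_pos hR ξ
  have h1 : HasFDerivAt (fun ξ : EuclideanSpace ℝ (Fin d) => ξ j)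
      (EuclideanSpace.proj j : EuclideanSpace ℝ (Fin d) →L[ℝ] ℝ) ξ :=
    (EuclideanSpace.proj j : EuclideanSpace ℝ (Fin d) →L[ℝ] ℝ).hasFDerivAt
  have hs : HasFDerivAt (coshDist R P) (fderiv ℝ (coshDist R P) ξ) ξ :=
    (hasFDerivAt_coshDist hR P ξ).differentiableAt.hasFDerivAt
  have h := ((h1.mul hs).sub_const (P j)).mul
    ((hasDerivAt_inv (mul_pos hR hh).ne').comp_hasFDerivAt ξ
      ((hasFDerivAt_height hR ξ).const_mul R))
  rw [partialDeriv_eq (f := gradCoshDist R P j)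
    (h.congr_of_eventuallyEq (.of_forall fun x => by simp [gradCoshDist, div_eq_mul_inv]))]
  simp [partialDeriv, inner_single_one]
  field_simp
  ring

/-- As `√|g| = R / height`, this says `Δs = d s / R²` for `s = coshDist R P`. -/
theorem sum_partialDeriv_gradCoshDist (hR : 0 < R) (P ξ : EuclideanSpace ℝ (Fin d)) :
    ∑ j, partialDeriv j (gradCoshDist R P j) ξ = d * coshDist R P ξ / (R * height R ξ) := by
  have hh := height_pos hR ξ
  have hh2 := height_sq (R := R) ξ
  have : ∑ j, partialDeriv j (gradCoshDist R P j) ξ =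
      (d * coshDist R P ξ + ∑ j, ξ j * partialDeriv j (coshDist R P) ξ) / (R * height R ξ) -
        (‖ξ‖ ^ 2 * coshDist R P ξ - ⟪P, ξ⟫) / (R * height R ξ ^ 3) := by
    rw [EuclideanSpace.real_norm_sq_eq, inner_eq_sum, Finset.sum_mul, ← Finset.sum_sub_distrib,
      Finset.sum_div, show (d : ℝ) * coshDist R P ξ = ∑ j : Fin d, coshDist R P ξ by simp,
      ← Finset.sum_add_distrib, Finset.sum_div, ← Finset.sum_sub_distrib]
    refine Finset.sum_congr rfl fun j _ => ?_
    rw [partialDeriv_gradCoshDist hR]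
    ring
  rw [this, sum_mul_partialDeriv_coshDist hR, show ‖ξ‖ ^ 2 = height R ξ ^ 2 - R ^ 2 by linarith,
    coshDist]
  field_simp
  ring

/-- This is `|grad s|² = (s² - 1) / R²`, multiplied by `√|g|`. -/
theorem sum_partialDeriv_mul_gradCoshDist (hR : 0 < R) (P ξ : EuclideanSpace ℝ (Fin d)) :
    ∑ j, partialDeriv j (coshDist R P) ξ * gradCoshDist R P j ξ =
      (coshDist R P ξ ^ 2 - 1) / (R * height R ξ) := by
  have hh := height_pos hR ξ
  have hP2 := height_sq (R := R) P
  have : ∑ j, partialDeriv j (coshDist R P) ξ * gradCoshDist R P j ξ =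
      (coshDist R P ξ * ∑ j, ξ j * partialDeriv j (coshDist R P) ξ -
        (height R P / height R ξ * ⟪P, ξ⟫ - ‖P‖ ^ 2) / R ^ 2) / (R * height R ξ) := by
    rw [EuclideanSpace.real_norm_sq_eq, inner_eq_sum, Finset.mul_sum, Finset.mul_sum,
      ← Finset.sum_sub_distrib, Finset.sum_div, ← Finset.sum_sub_distrib, Finset.sum_div]
    refine Finset.sum_congr rfl fun j _ => ?_
    rw [gradCoshDist, partialDeriv_coshDist hR]
    ring
  rw [this, sum_mul_partialDeriv_coshDist hR, show ‖P‖ ^ 2 = height R P ^ 2 - R ^ 2 by linarith,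
    coshDist]
  field_simp
  ring

theorem partialDeriv_comp_coshDist (hR : 0 < R) (P ξ : EuclideanSpace ℝ (Fin d)) {κ : ℝ → ℝ}
    {m : ℝ} (hκ : HasDerivAt κ m (coshDist R P ξ)) (i : Fin d) :
    partialDeriv i (fun ξ => κ (coshDist R P ξ)) ξ = m * partialDeriv i (coshDist R P) ξ := by
  have hs : HasFDerivAt (coshDist R P) (fderiv ℝ (coshDist R P) ξ) ξ :=
    (hasFDerivAt_coshDist hR P ξ).differentiableAt.hasFDerivAt
  rw [partialDeriv_eq (f := fun ξ => κ (coshDist R P ξ)) (hκ.comp_hasFDerivAt ξ hs)]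
  simp [partialDeriv]

/-- The divergence of `ψ(s) grad s`, which is the Laplacian of a primitive of `ψ` evaluated at `s`.
It vanishes away from the pole for `ψ` proportional to `(s² - 1)^(-d/2)`. -/
theorem sum_partialDeriv_comp_mul_gradCoshDist (hR : 0 < R) (P ξ : EuclideanSpace ℝ (Fin d))
    {ψ : ℝ → ℝ} (hψ : Differentiable ℝ ψ) :
    ∑ j, partialDeriv j (fun ξ => ψ (coshDist R P ξ) * gradCoshDist R P j ξ) ξ =
      (deriv ψ (coshDist R P ξ) * (coshDist R P ξ ^ 2 - 1) +
        d * coshDist R P ξ * ψ (coshDist R P ξ)) / (R * height R ξ) := by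
  have h1 : ∀ j, partialDeriv j (fun ξ => ψ (coshDist R P ξ) * gradCoshDist R P j ξ) ξ =
      deriv ψ (coshDist R P ξ) * (partialDeriv j (coshDist R P) ξ * gradCoshDist R P j ξ) +
        ψ (coshDist R P ξ) * partialDeriv j (gradCoshDist R P j) ξ := fun j => by
    have hc : HasFDerivAt (fun ξ => ψ (coshDist R P ξ)) (fderiv ℝ (fun ξ => ψ (coshDist R P ξ)) ξ)
        ξ := (hψ.differentiableAt.comp ξ
          (hasFDerivAt_coshDist hR P ξ).differentiableAt).hasFDerivAt
    have hg : HasFDerivAt (gradCoshDist R P j) (fderiv ℝ (gradCoshDist R P j) ξ) ξ :=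
      ((contDiff_gradCoshDist hR P j).differentiable (by simp) ξ).hasFDerivAt
    rw [← mul_assoc, ← partialDeriv_comp_coshDist hR P ξ (hψ _).hasDerivAt j,
      partialDeriv_eq (f := fun ξ => ψ (coshDist R P ξ) * gradCoshDist R P j ξ) (hc.mul hg)]
    simp [partialDeriv]
    ring
  simp only [h1]
  rw [Finset.sum_add_distrib, ← Finset.mul_sum, ← Finset.mul_sum,
    sum_partialDeriv_mul_gradCoshDist hR, sum_partialDeriv_gradCoshDist hR]
  ring

/-- Green's second identity for a test function and a smooth function of the distance to `P`. -/
theorem integral_densityLaplacian_mul (hR : 0 < R) (P : EuclideanSpace ℝ (Fin d))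
    {F : EuclideanSpace ℝ (Fin d) → ℝ} (hF : ContDiff ℝ ∞ F) (hFc : HasCompactSupport F)
    {κ ψ : ℝ → ℝ} (hκ : ∀ s, HasDerivAt κ (ψ s) s) (hψ : ContDiff ℝ 1 ψ) :
    ∫ ξ, densityLaplacian R F ξ * κ (coshDist R P ξ) =
      ∫ ξ, F ξ * ((deriv ψ (coshDist R P ξ) * (coshDist R P ξ ^ 2 - 1) +
        d * coshDist R P ξ * ψ (coshDist R P ξ)) / (R * height R ξ)) := by
  have hs1 : ContDiff ℝ 1 (coshDist R P) := (contDiff_coshDist hR P).of_le (by simp)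
  have hκ1 : ContDiff ℝ 1 κ := by
    have : deriv κ = ψ := funext fun s => (hκ s).deriv
    rw [contDiff_one_iff_deriv, this]
    exact ⟨fun s => (hκ s).differentiableAt, hψ.continuous⟩
  have hv : ContDiff ℝ 1 (fun ξ => κ (coshDist R P ξ)) := hκ1.comp hs1
  have hF1 : ContDiff ℝ 1 F := hF.of_le (by simp)
  have hA : ∀ i j, ContDiff ℝ 1 (fun η => dirichletCoeff R η i j * partialDeriv j F η) :=
    fun i j => ((contDiff_dirichletCoeff hR i j).mul
      (contDiff_partialDeriv hF le_rfl j)).of_le (by simp)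
  have hAc : ∀ i j, HasCompactSupport (fun η => dirichletCoeff R η i j * partialDeriv j F η) :=
    fun i j => (hasCompactSupport_partialDeriv hFc j).mul_left
  have hW : ∀ j, ContDiff ℝ 1 (fun ξ => ψ (coshDist R P ξ) * gradCoshDist R P j ξ) := fun j =>
    (hψ.comp hs1).mul ((contDiff_gradCoshDist hR P j).of_le (by simp))
  have hint1 : ∀ i j, Integrable (fun ξ => dirichletCoeff R ξ i j * partialDeriv j F ξ *
      partialDeriv i (fun ξ => κ (coshDist R P ξ)) ξ) := fun i j =>
    ((hA i j).continuous.mul (contDiff_partialDeriv (m := 0) hv (by simp) i).continuous)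
      |>.integrable_of_hasCompactSupport (hAc i j).mul_right
  calc ∫ ξ, densityLaplacian R F ξ * κ (coshDist R P ξ)
      = ∑ i, ∑ j, ∫ ξ, partialDeriv i (fun η => dirichletCoeff R η i j * partialDeriv j F η) ξ *
          κ (coshDist R P ξ) := by
        simp only [densityLaplacian, Finset.sum_mul]
        have hint : ∀ i j, Integrable (fun ξ => partialDeriv i
            (fun η => dirichletCoeff R η i j * partialDeriv j F η) ξ * κ (coshDist R P ξ)) :=
          fun i j => ((contDiff_partialDeriv (m := 0) (hA i j) (by simp) i).continuous.mul
            hv.continuous).integrable_of_hasCompactSupport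
            (hasCompactSupport_partialDeriv (hAc i j) i).mul_right
        rw [integral_finsetSum _ fun i _ => integrable_finsetSum _ fun j _ => hint i j]
        exact Finset.sum_congr rfl fun i _ => integral_finsetSum _ fun j _ => hint i j
    _ = -∑ j, ∑ i, ∫ ξ, dirichletCoeff R ξ i j * partialDeriv j F ξ *
          partialDeriv i (fun ξ => κ (coshDist R P ξ)) ξ := by
        rw [Finset.sum_comm, ← Finset.sum_neg_distrib]
        refine Finset.sum_congr rfl fun j _ => ?_
        rw [← Finset.sum_neg_distrib]
        exact Finset.sum_congr rfl fun i _ => integral_partialDeriv_mul (hA i j) (hAc i j) hv i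
    _ = -∑ j, ∫ ξ, partialDeriv j F ξ * (ψ (coshDist R P ξ) * gradCoshDist R P j ξ) := by
        congr 1
        refine Finset.sum_congr rfl fun j _ => ?_
        rw [← integral_finsetSum _ fun i _ => hint1 i j]
        refine integral_congr_ae (.of_forall fun ξ => ?_)
        simp only
        rw [← sum_dirichletCoeff_mul_partialDeriv hR, Finset.mul_sum, Finset.mul_sum]
        refine Finset.sum_congr rfl fun i _ => ?_
        rw [partialDeriv_comp_coshDist hR P ξ (hκ _)]
        ring
    -- Second integration by parts. Compact support of `F` removes all boundary terms.
    _ = ∑ j, ∫ ξ, F ξ * partialDeriv j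
          (fun ξ => ψ (coshDist R P ξ) * gradCoshDist R P j ξ) ξ := by
        rw [← Finset.sum_neg_distrib]
        refine Finset.sum_congr rfl fun j _ => ?_
        rw [integral_partialDeriv_mul hF1 hFc (hW j), neg_neg]
    _ = _ := by
        have hint : ∀ j, Integrable (fun ξ => F ξ * partialDeriv j
            (fun ξ => ψ (coshDist R P ξ) * gradCoshDist R P j ξ) ξ) := fun j =>
          (hF.continuous.mul (contDiff_partialDeriv (m := 0) (hW j) (by simp) j).continuous)
            |>.integrable_of_hasCompactSupport hFc.mul_right
        rw [← integral_finsetSum _ fun j _ => hint j]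
        refine integral_congr_ae (.of_forall fun ξ => ?_)
        simp only
        rw [← Finset.mul_sum,
          sum_partialDeriv_comp_mul_gradCoshDist hR P ξ (hψ.differentiable (by simp))]

end GreenIdentity

/-! ### Cutting off the singularity -/

section Cutoff

/-- `hypIntegral d` as a function of the hyperbolic cosine of the distance. -/
noncomputable def greenProfile (d : ℕ) (s : ℝ) : ℝ := hypIntegral d (Real.arcosh s)

theorem greenProfile_nonneg {d : ℕ} {s : ℝ} (hs : 1 ≤ s) : 0 ≤ greenProfile d s :=
  hypIntegral_nonneg (Real.arcosh_nonneg hs)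

theorem hasDerivAt_greenProfile {d : ℕ} (hd : 2 ≤ d) {s : ℝ} (hs : 1 < s) :
    HasDerivAt (greenProfile d) (-(s ^ 2 - 1) ^ (-((d : ℝ) / 2))) s := by
  have h0 : 0 < s ^ 2 - 1 := by nlinarith
  convert! (hasDerivAt_hypIntegral hd (Real.arcosh_pos hs)).comp s (Real.hasDerivAt_arcosh hs)
    using 1
  rw [Real.sinh_arcosh hs.le, neg_mul, one_div, ← mul_inv, ← pow_succ,
    show d - 1 + 1 = d by omega, Real.rpow_neg h0.le, Real.sqrt_eq_rpow,
    ← Real.rpow_mul_natCast h0.le]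
  congr 3
  ring

theorem greenProfile_le {d : ℕ} (hd : 2 ≤ d) {s : ℝ} (hs : 1 < s) :
    greenProfile d s ≤ 1 / Real.sqrt (s ^ 2 - 1) ^ (d - 1) := by
  have := hypIntegral_le hd (Real.arcosh_pos hs)
  rwa [Real.sinh_arcosh hs.le] at this

/-- A smooth step from `0` to `1` on the interval `[1 + 1/n, 1 + 2/n]`. -/
noncomputable def smoothStep (n s : ℝ) : ℝ := Real.smoothTransition (n * (s - 1) - 1)

section SmoothStep

variable {n : ℝ}

theorem contDiff_smoothStep (m : ℕ∞) : ContDiff ℝ m (smoothStep n) :=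
  Real.smoothTransition.contDiff.comp (by fun_prop)

theorem smoothStep_nonneg (s : ℝ) : 0 ≤ smoothStep n s := Real.smoothTransition.nonneg _

theorem smoothStep_le_one (s : ℝ) : smoothStep n s ≤ 1 := Real.smoothTransition.le_one _

theorem monotone_smoothStep (hn : 0 < n) : Monotone (smoothStep n) := fun s t h =>
  Real.smoothTransition.monotone (by gcongr)

theorem smoothStep_eq_zero (hn : 0 < n) {s : ℝ} (hs : s ≤ 1 + 1 / n) : smoothStep n s = 0 := by
  refine Real.smoothTransition.zero_of_nonpos ?_
  have : n * (s - 1) ≤ n * (1 / n) := by gcongr; linarith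
  rw [mul_one_div_cancel hn.ne'] at this
  linarith

theorem smoothStep_eq_one (hn : 0 < n) {s : ℝ} (hs : 1 + 2 / n ≤ s) : smoothStep n s = 1 := by
  refine Real.smoothTransition.one_of_one_le ?_
  have : n * (2 / n) ≤ n * (s - 1) := by gcongr; linarith
  rw [mul_div_cancel₀ _ hn.ne'] at this
  linarith

theorem smoothStep_eventuallyEq_zero (hn : 0 < n) {s : ℝ} (hs : s ≤ 1) :
    smoothStep n =ᶠ[𝓝 s] 0 := by
  have : s < 1 + 1 / n := by
    have : 0 < 1 / n := by positivity
    linarith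
  filter_upwards [gt_mem_nhds this] with t ht
  exact smoothStep_eq_zero hn (le_of_lt ht)

theorem hasDerivAt_smoothStep (s : ℝ) : HasDerivAt (smoothStep n) (deriv (smoothStep n) s) s :=
  ((contDiff_smoothStep 1).differentiable (by simp) s).hasDerivAt

theorem deriv_smoothStep_nonneg (hn : 0 < n) (s : ℝ) : 0 ≤ deriv (smoothStep n) s :=
  (monotone_smoothStep hn).deriv_nonneg

theorem deriv_smoothStep_eq_zero (hn : 0 < n) {s : ℝ} (hs : 1 + 2 / n < s) :
    deriv (smoothStep n) s = 0 := by
  have : smoothStep n =ᶠ[𝓝 s] fun _ => 1 := by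
    filter_upwards [lt_mem_nhds hs] with t ht
    exact smoothStep_eq_one hn (le_of_lt ht)
  rw [this.deriv_eq, deriv_const]

/-- The derivative of `greenProfile d`, cut off near its singularity. -/
noncomputable def cutoffDeriv (d : ℕ) (n s : ℝ) : ℝ :=
  -(smoothStep n s * (s ^ 2 - 1) ^ (-((d : ℝ) / 2)))

theorem cutoffDeriv_eventuallyEq_zero (d : ℕ) (hn : 0 < n) {s : ℝ} (hs : s ≤ 1) :
    cutoffDeriv d n =ᶠ[𝓝 s] 0 := by
  filter_upwards [smoothStep_eventuallyEq_zero hn hs] with t ht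
  simp [cutoffDeriv, ht]

theorem contDiff_cutoffDeriv (d : ℕ) (hn : 0 < n) : ContDiff ℝ 1 (cutoffDeriv d n) := by
  rw [contDiff_iff_contDiffAt]
  intro s
  rcases le_or_gt s 1 with hs | hs
  · exact contDiffAt_const.congr_of_eventuallyEq (cutoffDeriv_eventuallyEq_zero d hn hs)
  · have h0 : s ^ 2 - 1 ≠ 0 := by nlinarith
    refine ((contDiff_smoothStep 1).contDiffAt.mul ?_).neg
    exact ContDiffAt.rpow_const_of_ne (by fun_prop) h0

/-- The power `(s² - 1)^(-d/2)` solves the homogeneous equation, so only the derivative of the step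
remains. For `s ≤ 1` all terms vanish near `s`, so the identity holds on the whole line. -/
theorem deriv_cutoffDeriv (d : ℕ) (hn : 0 < n) (s : ℝ) :
    deriv (cutoffDeriv d n) s * (s ^ 2 - 1) + d * s * cutoffDeriv d n s =
      -(deriv (smoothStep n) s * (s ^ 2 - 1) ^ (1 - (d : ℝ) / 2)) := by
  rcases le_or_gt s 1 with hs | hs
  · rw [(cutoffDeriv_eventuallyEq_zero d hn hs).deriv_eq,
      (smoothStep_eventuallyEq_zero hn hs).deriv_eq,
      (cutoffDeriv_eventuallyEq_zero d hn hs).eq_of_nhds]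
    simp
  · have h0 : 0 < s ^ 2 - 1 := by nlinarith
    have h1 : HasDerivAt (fun s : ℝ => s ^ 2 - 1) (2 * s) s := by
      simpa using (hasDerivAt_pow 2 s).sub_const 1
    have h := ((hasDerivAt_smoothStep (n := n) s).fun_mul
      (h1.rpow_const (p := -((d : ℝ) / 2)) (Or.inl h0.ne'))).fun_neg
    change HasDerivAt (cutoffDeriv d n) _ s at h
    rw [h.deriv, cutoffDeriv, Real.rpow_sub_one h0.ne', show 1 - (d : ℝ) / 2 = -((d : ℝ) / 2) + 1 by ring,
      Real.rpow_add_one h0.ne']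
    field_simp
    ring

theorem cutoffDeriv_eq (d : ℕ) (hn : 0 < n) {s : ℝ} (hs : 1 + 2 / n ≤ s) :
    cutoffDeriv d n s = -(s ^ 2 - 1) ^ (-((d : ℝ) / 2)) := by
  rw [cutoffDeriv, smoothStep_eq_one hn hs, one_mul]

/-- The function `greenProfile d`, cut off near its singularity. -/
noncomputable def cutoffProfile (d : ℕ) (n s : ℝ) : ℝ :=
  greenProfile d 2 + ∫ t in (2 : ℝ)..s, cutoffDeriv d n t

theorem hasDerivAt_cutoffProfile (d : ℕ) (hn : 0 < n) (s : ℝ) :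
    HasDerivAt (cutoffProfile d n) (cutoffDeriv d n s) s :=
  ((contDiff_cutoffDeriv d hn).continuous.integral_hasStrictDerivAt 2 s).hasDerivAt.const_add _

theorem cutoffProfile_eq {d : ℕ} (hd : 2 ≤ d) (hn : 2 ≤ n) {s : ℝ} (hs : 1 + 2 / n ≤ s) :
    cutoffProfile d n s = greenProfile d s := by
  have hn0 : 0 < n := by linarith
  -- For `n ≥ 2` the step is complete by the base point `2` of the primitive, so the cut off and
  -- uncut profiles already agree there.
  have h2 : 1 + 2 / n ≤ 2 := by
    have : 2 / n ≤ 1 := (div_le_one hn0).2 hn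
    linarith
  have hpos : 0 < 2 / n := by positivity
  have hI : ∀ t ∈ uIcc 2 s, 1 + 2 / n ≤ t := fun t ht => (le_min h2 hs).trans ht.1
  have h := intervalIntegral.integral_eq_sub_of_hasDerivAt (a := 2) (b := s)
    (f := greenProfile d) (f' := cutoffDeriv d n) (fun t ht => by
      rw [cutoffDeriv_eq d hn0 (hI t ht)]
      exact hasDerivAt_greenProfile hd (by linarith [hI t ht]))
    ((contDiff_cutoffDeriv d hn0).continuous.intervalIntegrable _ _)
  rw [cutoffProfile, h]
  ring

/-- Between `s` and `2` the slope has only been multiplied by a factor in `[0, 1]`. The resulting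
majorant does not depend on `n`, as dominated convergence requires. -/
theorem abs_cutoffProfile_le {d : ℕ} (hd : 2 ≤ d) (hn : 2 ≤ n) {s : ℝ} (hs : 1 < s) :
    |cutoffProfile d n s| ≤ greenProfile d s := by
  have hn0 : 0 < n := by linarith
  have h2 : 1 + 2 / n ≤ 2 := by
    have : 2 / n ≤ 1 := (div_le_one hn0).2 hn
    linarith
  rcases le_total (1 + 2 / n) s with h | h
  · rw [cutoffProfile_eq hd hn h, abs_of_nonneg (greenProfile_nonneg hs.le)]
  · have hs2 : s ≤ 2 := h.trans h2
    have hcont : ContinuousOn (fun t : ℝ => (t ^ 2 - 1) ^ (-((d : ℝ) / 2))) (uIcc s 2) := by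
      refine ContinuousOn.rpow_const (by fun_prop) fun t ht => Or.inl ?_
      rw [uIcc_of_le hs2] at ht
      nlinarith [ht.1]
    have hFTC := intervalIntegral.integral_eq_sub_of_hasDerivAt (a := s) (b := 2)
      (f := greenProfile d) (f' := fun t => -(t ^ 2 - 1) ^ (-((d : ℝ) / 2))) (fun t ht => by
        rw [uIcc_of_le hs2] at ht
        exact hasDerivAt_greenProfile hd (hs.trans_le ht.1)) hcont.neg.intervalIntegrable
    have hint := (contDiff_cutoffDeriv d hn0).continuous.intervalIntegrable (μ := volume) s 2
    have hle : ∫ t in s..2, -cutoffDeriv d n t ≤ ∫ t in s..2, (t ^ 2 - 1) ^ (-((d : ℝ) / 2)) := by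
      refine intervalIntegral.integral_mono_on hs2 hint.neg hcont.intervalIntegrable fun t ht => ?_
      have : 0 ≤ t ^ 2 - 1 := by nlinarith [ht.1]
      rw [cutoffDeriv, neg_neg]
      exact mul_le_of_le_one_left (by positivity) (smoothStep_le_one t)
    have hge : 0 ≤ ∫ t in s..2, -cutoffDeriv d n t := by
      refine intervalIntegral.integral_nonneg hs2 fun t ht => ?_
      have : 0 ≤ t ^ 2 - 1 := by nlinarith [ht.1]
      rw [cutoffDeriv, neg_neg]
      exact mul_nonneg (smoothStep_nonneg t) (by positivity)
    have h3 : 0 ≤ greenProfile d 2 := greenProfile_nonneg (by norm_num)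
    rw [intervalIntegral.integral_neg] at hFTC hle hge
    rw [cutoffProfile, intervalIntegral.integral_symm, abs_of_nonneg (by linarith)]
    linarith

end SmoothStep

/-! ### The approximate Dirac mass at the origin -/

section Mass

variable {d : ℕ} {R n : ℝ}

/-- The density of the approximation of the Dirac distribution at the origin. -/
noncomputable def bump (d : ℕ) (R n : ℝ) {E : Type*} [NormedAddCommGroup E] (ξ : E) : ℝ :=
  deriv (smoothStep n) (height R ξ / R) * ((height R ξ / R) ^ 2 - 1) ^ (1 - (d : ℝ) / 2) /
    (R * height R ξ)

theorem height_norm {E : Type*} [NormedAddCommGroup E] (ξ : E) : height R ‖ξ‖ = height R ξ := by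
  simp [height]

theorem height_div_sq_sub_one (hR : 0 < R) {E : Type*} [NormedAddCommGroup E] (ξ : E) :
    (height R ξ / R) ^ 2 - 1 = (‖ξ‖ / R) ^ 2 := by
  rw [div_pow, height_sq]
  field_simp
  ring

theorem one_le_height_div (hR : 0 < R) {E : Type*} [NormedAddCommGroup E] (ξ : E) :
    1 ≤ height R ξ / R := (one_le_div hR).2 (le_height ξ)

theorem bump_nonneg (hR : 0 < R) (hn : 0 < n) {E : Type*} [NormedAddCommGroup E] (ξ : E) :
    0 ≤ bump d R n ξ := by
  have h1 := height_pos hR ξ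
  have h2 := deriv_smoothStep_nonneg hn (height R ξ / R)
  have h3 := one_le_height_div hR ξ
  unfold bump
  rw [height_div_sq_sub_one hR]
  positivity

theorem hasDerivAt_smoothStep_height (hR : 0 < R) (r : ℝ) :
    HasDerivAt (fun r : ℝ => smoothStep n (height R r / R))
      (deriv (smoothStep n) (height R r / R) * (r / (R * height R r))) r := by
  have h1 : HasDerivAt (height R : ℝ → ℝ) (r / height R r) r := by
    have := (hasFDerivAt_height hR r).hasDerivAt
    simpa [div_eq_inv_mul] using this
  convert! (hasDerivAt_smoothStep (n := n) (height R r / R)).comp r (h1.div_const R) using 1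
  have := height_pos hR r
  field_simp

/-- Under `s = height R r / R` the integrand is an exact derivative, and the step rises by `1` in
total. -/
theorem integral_deriv_smoothStep_height (hR : 0 < R) (hn : 0 < n) :
    ∫ r in Ioi (0 : ℝ), deriv (smoothStep n) (height R r / R) * (r / (R * height R r)) = 1 := by
  have hlim : Tendsto (fun r : ℝ => smoothStep n (height R r / R)) atTop (𝓝 1) := by
    refine tendsto_const_nhds.congr' ?_
    filter_upwards [eventually_ge_atTop (R * (1 + 2 / n))] with r hr
    refine (smoothStep_eq_one hn ?_).symm
    rw [le_div_iff₀ hR, mul_comm]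
    exact hr.trans ((le_abs_self r).trans (norm_le_height r))
  have hpos : ∀ r ∈ Ioi (0 : ℝ),
      0 ≤ deriv (smoothStep n) (height R r / R) * (r / (R * height R r)) := fun r hr => by
    have h1 := height_pos hR r
    have h2 := deriv_smoothStep_nonneg hn (height R r / R)
    have h3 : 0 ≤ r := le_of_lt hr
    positivity
  have h := integral_Ioi_of_hasDerivAt_of_nonneg' (fun r _ => hasDerivAt_smoothStep_height hR r)
    hpos hlim
  rw [h, (height_eq_iff hR (0 : ℝ)).2 rfl, div_self hR.ne', smoothStep_eq_zero hn, sub_zero]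
  have : 0 < 1 / n := by positivity
  linarith

/-- In polar coordinates `(s² - 1)^(1 - d/2) = (r / R)^(2 - d)` cancels all but one power of
`r^(d-1)`. What remains is `R^(d-2)` times the exact derivative, whatever `n` is. -/
theorem integral_bump (hd : 2 ≤ d) (hR : 0 < R) (hn : 0 < n) :
    ∫ ξ : EuclideanSpace ℝ (Fin d), bump d R n ξ =
      d * volume.real (Metric.ball (0 : EuclideanSpace ℝ (Fin d)) 1) * R ^ (d - 2) := by
  have : Nonempty (Fin d) := ⟨⟨0, by omega⟩⟩
  have h1 : ∀ ξ : EuclideanSpace ℝ (Fin d), bump d R n ξ = bump d R n ‖ξ‖ := fun ξ => by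
    simp only [bump, height_norm]
  simp_rw [h1]
  rw [integral_fun_norm_addHaar volume (fun r : ℝ => bump d R n r), finrank_euclideanSpace_fin]
  have h2 : ∫ y in Ioi (0 : ℝ), y ^ (d - 1) • bump d R n y = R ^ (d - 2) := by
    rw [← mul_one (R ^ (d - 2)), ← integral_deriv_smoothStep_height hR hn, ← integral_const_mul]
    refine setIntegral_congr_fun measurableSet_Ioi fun r hr => ?_
    have hr : 0 < r := hr
    have hh := height_pos hR r
    obtain ⟨m, rfl⟩ := Nat.exists_eq_add_of_le' hd
    simp only [bump, smul_eq_mul]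
    rw [height_div_sq_sub_one hR, Real.norm_of_nonneg hr.le, ← Real.rpow_natCast _ 2,
      ← Real.rpow_mul (by positivity),
      show ((2 : ℕ) : ℝ) * (1 - ((m + 2 : ℕ) : ℝ) / 2) = -(m : ℝ) by push_cast; ring,
      Real.rpow_neg (by positivity), Real.rpow_natCast, div_pow,
      show m + 2 - 1 = m + 1 by omega, show m + 2 - 2 = m by omega]
    field_simp
    ring
  rw [h2]
  simp [mul_assoc]

theorem bump_eq_zero (hR : 0 < R) (hn : 0 < n) {E : Type*} [NormedAddCommGroup E] {ξ : E}
    (h : (1 + 2 / n) ^ 2 - 1 < (‖ξ‖ / R) ^ 2) : bump d R n ξ = 0 := by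
  have h1 : 1 + 2 / n < height R ξ / R := by
    refine lt_of_pow_lt_pow_left₀ 2 (zero_le_one.trans (one_le_height_div hR ξ)) ?_
    linarith [height_div_sq_sub_one hR ξ]
  simp [bump, deriv_smoothStep_eq_zero hn h1]

theorem integral_bump_pos (hd : 2 ≤ d) (hR : 0 < R) :
    0 < d * volume.real (Metric.ball (0 : EuclideanSpace ℝ (Fin d)) 1) * R ^ (d - 2) := by
  have h1 : 0 < volume.real (Metric.ball (0 : EuclideanSpace ℝ (Fin d)) 1) :=
    ENNReal.toReal_pos (Metric.measure_ball_pos _ _ one_pos).ne' measure_ball_lt_top.ne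
  have h2 : (0 : ℝ) < d := by exact_mod_cast (by omega : 0 < d)
  positivity

/-- The Bochner integral of a non-integrable function is `0`, whereas the integral just computed is
positive. -/
theorem integrable_bump (hd : 2 ≤ d) (hR : 0 < R) (hn : 0 < n) :
    Integrable (bump d R n : EuclideanSpace ℝ (Fin d) → ℝ) := by
  by_contra h
  have h1 := integral_bump hd hR hn
  rw [integral_undef h] at h1
  exact (integral_bump_pos hd hR).ne h1

theorem tendsto_integral_mul_bump (hd : 2 ≤ d) (hR : 0 < R) {G : EuclideanSpace ℝ (Fin d) → ℝ}
    (hG : Continuous G) {C : ℝ} (hC : ∀ ξ, ‖G ξ‖ ≤ C) :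
    Tendsto (fun n : ℕ => ∫ ξ, G ξ * bump d R n ξ) atTop
      (𝓝 (G 0 * (d * volume.real (Metric.ball (0 : EuclideanSpace ℝ (Fin d)) 1) *
        R ^ (d - 2)))) := by
  set m := d * volume.real (Metric.ball (0 : EuclideanSpace ℝ (Fin d)) 1) * R ^ (d - 2)
  have hm : 0 < m := integral_bump_pos hd hR
  rw [Metric.tendsto_atTop']
  intro ε hε
  -- With `m` the total mass, this tolerance bounds the error by `ε / 2`, which leaves room for a
  -- strict inequality.
  obtain ⟨δ, hδ, hGδ⟩ := Metric.continuousAt_iff.1 (hG.continuousAt (x := 0)) (ε / (2 * m)) (by positivity)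
  have hlim : Tendsto (fun n : ℕ => (1 + 2 / (n : ℝ)) ^ 2 - 1) atTop (𝓝 0) := by
    have : Tendsto (fun n : ℕ => 2 / (n : ℝ)) atTop (𝓝 0) :=
      tendsto_const_div_atTop_nhds_zero_nat 2
    simpa using ((this.const_add 1).pow 2).sub_const 1
  obtain ⟨N, hN⟩ := eventually_atTop.1
    (hlim.eventually_lt_const (show 0 < (δ / R) ^ 2 by positivity))
  refine ⟨N, fun n hn => ?_⟩
  have hn0 : (0 : ℝ) < n := by exact_mod_cast (Nat.zero_le N).trans_lt hn
  have hb := integrable_bump hd hR hn0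
  have hGb : Integrable (fun ξ => G ξ * bump d R n ξ) :=
    hb.bdd_mul hG.aestronglyMeasurable (.of_forall hC)
  have e : (∫ ξ, G ξ * bump d R n ξ) - G 0 * m = ∫ ξ, (G ξ - G 0) * bump d R n ξ := by
    simp_rw [sub_mul]
    rw [integral_sub hGb (hb.const_mul _), integral_const_mul, integral_bump hd hR hn0]
  rw [Real.dist_eq, e, ← Real.norm_eq_abs]
  have hle : ‖∫ ξ, (G ξ - G 0) * bump d R n ξ‖ ≤
      ∫ ξ : EuclideanSpace ℝ (Fin d), ε / (2 * m) * bump d R n ξ := by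
    refine norm_integral_le_of_norm_le (hb.const_mul _) (.of_forall fun ξ => ?_)
    rw [norm_mul, Real.norm_of_nonneg (bump_nonneg hR hn0 ξ)]
    rcases lt_or_ge ‖ξ‖ δ with h | h
    · have := hGδ (x := ξ) (by simpa using h)
      rw [Real.dist_eq, ← Real.norm_eq_abs] at this
      gcongr
      exact bump_nonneg hR hn0 ξ
    · rw [bump_eq_zero hR hn0 ((hN n hn.le).trans_le (by gcongr))]
      simp
  rw [integral_const_mul, integral_bump hd hR hn0] at hle
  refine hle.trans_lt ?_
  change ε / (2 * m) * m < ε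
  field_simp
  norm_num

end Mass

end Cutoff

/-! ### Passage to the limit and the fundamental solution -/

section FundamentalSolution

variable {d : ℕ} {R : ℝ}

theorem coordVolume_le (hR : 0 < R) :
    coordVolume R (EuclideanSpace ℝ (Fin d)) ≤ volume := by
  calc coordVolume R (EuclideanSpace ℝ (Fin d)) ≤ volume.withDensity 1 :=
        withDensity_mono (.of_forall fun ξ => by
          simpa using (div_le_one (height_pos hR ξ)).2 (le_height ξ))
    _ = volume := withDensity_one

theorem measurable_ofReal_div_height :
    Measurable fun ξ : EuclideanSpace ℝ (Fin d) => ENNReal.ofReal (R / height R ξ) :=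
  ENNReal.measurable_ofReal.comp (measurable_const.div continuous_height.measurable)

theorem integral_coordVolume (hR : 0 < R) (f : EuclideanSpace ℝ (Fin d) → ℝ) :
    ∫ ξ, f ξ ∂coordVolume R (EuclideanSpace ℝ (Fin d)) = ∫ ξ, R / height R ξ * f ξ := by
  rw [coordVolume, integral_withDensity_eq_integral_toReal_smul measurable_ofReal_div_height
    (.of_forall fun _ => ENNReal.ofReal_lt_top)]
  refine integral_congr_ae (.of_forall fun ξ => ?_)
  have := height_pos hR ξ
  simp only [smul_eq_mul]
  rw [ENNReal.toReal_ofReal (by positivity)]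

theorem continuousOn_greenProfile_coshDist (hd : 2 ≤ d) (hR : 0 < R)
    (P : EuclideanSpace ℝ (Fin d)) :
    ContinuousOn (fun ξ => greenProfile d (coshDist R P ξ)) {P}ᶜ := fun _ hξ =>
  ((hasDerivAt_greenProfile hd (one_lt_coshDist hR hξ)).continuousAt.comp
    (contDiff_coshDist hR P).continuous.continuousAt).continuousWithinAt

theorem aestronglyMeasurable_greenProfile_coshDist (hd : 2 ≤ d) (hR : 0 < R)
    (P : EuclideanSpace ℝ (Fin d)) :
    AEStronglyMeasurable (fun ξ => greenProfile d (coshDist R P ξ)) volume := by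
  have : Nonempty (Fin d) := ⟨⟨0, by omega⟩⟩
  have h := (continuousOn_greenProfile_coshDist hd hR P).aestronglyMeasurable (μ := volume)
    (measurableSet_singleton P).compl
  rwa [restrict_compl_singleton] at h

/-- At the origin `√(s² - 1) = ‖ξ‖ / R`, so the profile is at most `(R / ‖ξ‖)^(d-1)`. The polar
Jacobian `r^(d-1)` cancels this exactly. -/
theorem locallyIntegrable_greenProfile_height (hd : 2 ≤ d) (hR : 0 < R) :
    LocallyIntegrable
      (fun ξ : EuclideanSpace ℝ (Fin d) => greenProfile d (coshDist R 0 ξ)) volume := by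
  have : Nonempty (Fin d) := ⟨⟨0, by omega⟩⟩
  intro ξ
  refine ⟨Metric.ball 0 (‖ξ‖ + 1), Metric.isOpen_ball.mem_nhds (by simp), ?_⟩
  have h1 : IntegrableOn (fun ξ : EuclideanSpace ℝ (Fin d) => (R / ‖ξ‖) ^ (d - 1))
      (Metric.ball 0 (‖ξ‖ + 1)) := by
    rw [integrableOn_fun_norm_addHaar volume (f := fun r => (R / r) ^ (d - 1)),
      finrank_euclideanSpace_fin]
    refine (integrableOn_congr_fun (g := fun _ => R ^ (d - 1)) (fun r hr => ?_)
      measurableSet_Ioo).2 (integrableOn_const (by simp))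
    have : r ≠ 0 := hr.1.ne'
    simp only [smul_eq_mul]
    rw [← mul_pow]
    field_simp
  refine Integrable.mono' h1
    (aestronglyMeasurable_greenProfile_coshDist hd hR 0).restrict ?_
  refine ae_restrict_of_ae ?_
  have hne : ∀ᵐ η : EuclideanSpace ℝ (Fin d), η ≠ 0 :=
    compl_mem_ae_iff.2 (measure_singleton 0)
  filter_upwards [hne] with η hη
  have hs := one_lt_coshDist hR hη
  rw [Real.norm_of_nonneg (greenProfile_nonneg hs.le)]
  refine (greenProfile_le hd hs).trans_eq ?_
  rw [coshDist_zero hR, height_div_sq_sub_one hR, Real.sqrt_sq (by positivity), one_div, ← inv_pow,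
    inv_div]

/-- `pointReflection` as a homeomorphism. -/
noncomputable def pointReflectionHomeomorph (hR : 0 < R) (P : EuclideanSpace ℝ (Fin d)) :
    EuclideanSpace ℝ (Fin d) ≃ₜ EuclideanSpace ℝ (Fin d) where
  toEquiv := (pointReflection_involutive hR P).toPerm
  continuous_toFun := continuous_pointReflection P
  continuous_invFun := continuous_pointReflection P

theorem coshDist_pointReflection_eq (hR : 0 < R) (P ξ : EuclideanSpace ℝ (Fin d)) :
    coshDist R P (pointReflection R P ξ) = coshDist R 0 ξ := by
  rw [coshDist_pointReflection hR, coshDist_zero hR]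

theorem locallyIntegrable_greenProfile (hd : 2 ≤ d) (hR : 0 < R)
    (P : EuclideanSpace ℝ (Fin d)) :
    LocallyIntegrable (fun ξ => greenProfile d (coshDist R P ξ))
      (coordVolume R (EuclideanSpace ℝ (Fin d))) := by
  have h0 : LocallyIntegrable
      (fun ξ : EuclideanSpace ℝ (Fin d) => greenProfile d (coshDist R 0 ξ))
      (coordVolume R (EuclideanSpace ℝ (Fin d))) := fun ξ =>
    let ⟨U, hU, hint⟩ := locallyIntegrable_greenProfile_height hd hR ξ
    ⟨U, hU, hint.mono_measure (coordVolume_le hR)⟩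
  have hmap : Measure.map (pointReflectionHomeomorph hR P)
      (coordVolume R (EuclideanSpace ℝ (Fin d))) = coordVolume R (EuclideanSpace ℝ (Fin d)) :=
    (measurePreserving_pointReflection hR P).map_eq
  rw [← hmap, locallyIntegrable_map_homeomorph]
  refine h0.congr (.of_forall fun ξ => ?_)
  simp only [Function.comp_apply]
  rw [← coshDist_pointReflection_eq hR P]
  rfl

/-- The Laplacian of a test function integrated against the cut off Green function. -/
theorem integral_laplaceBeltrami_mul_cutoffProfile (hR : 0 < R) (P : EuclideanSpace ℝ (Fin d))
    {F : EuclideanSpace ℝ (Fin d) → ℝ} (hF : ContDiff ℝ ∞ F) (hFc : HasCompactSupport F)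
    {n : ℝ} (hn : 0 < n) :
    ∫ ξ, laplaceBeltrami (hyperboloidMetric R) F ξ * cutoffProfile d n (coshDist R P ξ)
        ∂coordVolume R (EuclideanSpace ℝ (Fin d)) =
      -∫ ξ, F (pointReflection R P ξ) * bump d R n ξ := by
  have hk : ∀ ξ : EuclideanSpace ℝ (Fin d), R / height R ξ * R⁻¹ ^ 2 = 1 / (R * height R ξ) :=
    fun ξ => by
      have := height_pos hR ξ
      field_simp
  have h1 : ∫ ξ, laplaceBeltrami (hyperboloidMetric R) F ξ * cutoffProfile d n (coshDist R P ξ)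
        ∂coordVolume R (EuclideanSpace ℝ (Fin d)) =
      ∫ ξ, densityLaplacian R F ξ * cutoffProfile d n (coshDist R P ξ) := by
    rw [integral_coordVolume hR]
    refine integral_congr_ae (.of_forall fun ξ => ?_)
    have := height_pos hR ξ
    simp only [laplaceBeltrami_hyperboloidMetric hR]
    field_simp
  have h2 : ∫ ξ, densityLaplacian R F ξ * cutoffProfile d n (coshDist R P ξ) =
      ∫ ξ, -(F ξ * (deriv (smoothStep n) (coshDist R P ξ) *
        (coshDist R P ξ ^ 2 - 1) ^ (1 - (d : ℝ) / 2) * R⁻¹ ^ 2))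
        ∂coordVolume R (EuclideanSpace ℝ (Fin d)) := by
    rw [integral_densityLaplacian_mul hR P hF hFc (hasDerivAt_cutoffProfile d hn)
      (contDiff_cutoffDeriv d hn), integral_coordVolume hR]
    refine integral_congr_ae (.of_forall fun ξ => ?_)
    simp only [deriv_cutoffDeriv d hn]
    linear_combination (F ξ * (deriv (smoothStep n) (coshDist R P ξ) *
        (coshDist R P ξ ^ 2 - 1) ^ (1 - (d : ℝ) / 2))) * hk ξ
  -- The reflection moves the pole from `P` to the origin, where the density becomes the radial
  -- function `bump`.
  rw [h1, h2, integral_neg, ← (measurePreserving_pointReflection hR P).integral_comp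
    (pointReflectionHomeomorph hR P).measurableEmbedding, integral_coordVolume hR]
  congr 1
  refine integral_congr_ae (.of_forall fun ξ => ?_)
  simp only [coshDist_pointReflection hR, bump]
  linear_combination (F (pointReflection R P ξ) * (deriv (smoothStep n) (height R ξ / R) *
    ((height R ξ / R) ^ 2 - 1) ^ (1 - (d : ℝ) / 2))) * hk ξ

theorem continuous_laplaceBeltrami (hR : 0 < R) {F : EuclideanSpace ℝ (Fin d) → ℝ}
    (hF : ContDiff ℝ ∞ F) : Continuous (laplaceBeltrami (hyperboloidMetric R) F) := by
  have h : laplaceBeltrami (hyperboloidMetric R) F =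
      fun ξ => height R ξ / R * densityLaplacian R F ξ :=
    funext fun ξ => laplaceBeltrami_hyperboloidMetric hR F ξ
  rw [h]
  exact (continuous_height.div_const R).mul (contDiff_densityLaplacian hR hF).continuous

theorem hasCompactSupport_laplaceBeltrami (hR : 0 < R) {F : EuclideanSpace ℝ (Fin d) → ℝ}
    (hF : HasCompactSupport F) : HasCompactSupport (laplaceBeltrami (hyperboloidMetric R) F) := by
  have h : laplaceBeltrami (hyperboloidMetric R) F =
      fun ξ => height R ξ / R * densityLaplacian R F ξ :=
    funext fun ξ => laplaceBeltrami_hyperboloidMetric hR F ξ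
  rw [h]
  exact (hasCompactSupport_densityLaplacian hF).mul_left

theorem integrable_laplaceBeltrami_mul_greenProfile (hd : 2 ≤ d) (hR : 0 < R)
    (P : EuclideanSpace ℝ (Fin d)) {F : EuclideanSpace ℝ (Fin d) → ℝ} (hF : ContDiff ℝ ∞ F)
    (hFc : HasCompactSupport F) :
    Integrable (fun ξ => laplaceBeltrami (hyperboloidMetric R) F ξ *
      greenProfile d (coshDist R P ξ)) (coordVolume R (EuclideanSpace ℝ (Fin d))) := by
  have h := (locallyIntegrable_greenProfile hd hR P).integrable_smul_left_of_hasCompactSupport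
    (continuous_laplaceBeltrami hR hF) (hasCompactSupport_laplaceBeltrami hR hFc)
  simpa only [smul_eq_mul] using h

/-- The integral against the cut off profile has two limits as `n → ∞`: this one by dominated
convergence, and the value at `P` times the mass of the bumps. -/
theorem integral_laplaceBeltrami_mul_greenProfile (hd : 2 ≤ d) (hR : 0 < R)
    (P : EuclideanSpace ℝ (Fin d)) {F : EuclideanSpace ℝ (Fin d) → ℝ} (hF : ContDiff ℝ ∞ F)
    (hFc : HasCompactSupport F) :
    ∫ ξ, laplaceBeltrami (hyperboloidMetric R) F ξ * greenProfile d (coshDist R P ξ)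
        ∂coordVolume R (EuclideanSpace ℝ (Fin d)) =
      -(F P * (d * volume.real (Metric.ball (0 : EuclideanSpace ℝ (Fin d)) 1) *
        R ^ (d - 2))) := by
  have : Nonempty (Fin d) := ⟨⟨0, by omega⟩⟩
  have hne : ∀ᵐ ξ ∂coordVolume R (EuclideanSpace ℝ (Fin d)), ξ ≠ P :=
    (withDensity_absolutelyContinuous volume _).ae_le
      (compl_mem_ae_iff.2 (measure_singleton P))
  have hlim1 : Tendsto (fun n : ℕ => ∫ ξ, laplaceBeltrami (hyperboloidMetric R) F ξ *
        cutoffProfile d n (coshDist R P ξ) ∂coordVolume R (EuclideanSpace ℝ (Fin d))) atTop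
      (𝓝 (∫ ξ, laplaceBeltrami (hyperboloidMetric R) F ξ * greenProfile d (coshDist R P ξ)
        ∂coordVolume R (EuclideanSpace ℝ (Fin d)))) := by
    refine tendsto_integral_filter_of_dominated_convergence _ ?_ ?_
      (integrable_laplaceBeltrami_mul_greenProfile hd hR P hF hFc).norm ?_
    · filter_upwards [eventually_gt_atTop 0] with n hn
      have hc : Continuous (cutoffProfile d n) := continuous_iff_continuousAt.2 fun s =>
        (hasDerivAt_cutoffProfile d (by exact_mod_cast hn) s).continuousAt
      exact ((continuous_laplaceBeltrami hR hF).mul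
        (hc.comp (contDiff_coshDist hR P).continuous)).aestronglyMeasurable
    · filter_upwards [eventually_ge_atTop 2] with n hn
      filter_upwards [hne] with ξ hξ
      have hs := one_lt_coshDist hR hξ
      rw [norm_mul, norm_mul, Real.norm_of_nonneg (greenProfile_nonneg hs.le), Real.norm_eq_abs
        (cutoffProfile _ _ _)]
      gcongr
      exact abs_cutoffProfile_le hd (by exact_mod_cast hn) hs
    · filter_upwards [hne] with ξ hξ
      have hs := one_lt_coshDist hR hξ
      -- At a fixed point other than `P` the sequence is eventually constant, since `1 + 2 / n`
      -- drops below `s`.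
      refine tendsto_const_nhds.congr' ?_
      have h2 : Tendsto (fun n : ℕ => 1 + 2 / (n : ℝ)) atTop (𝓝 1) := by
        simpa using (tendsto_const_div_atTop_nhds_zero_nat (2 : ℝ)).const_add 1
      filter_upwards [h2.eventually_lt_const hs, eventually_ge_atTop 2] with n hn hn2
      rw [cutoffProfile_eq hd (by exact_mod_cast hn2) hn.le]
  obtain ⟨C, hC⟩ := hFc.exists_bound_of_continuous hF.continuous
  have hlim2 := (tendsto_integral_mul_bump hd hR (G := fun ξ => F (pointReflection R P ξ))
    (hF.continuous.comp (continuous_pointReflection P)) fun ξ => hC _).neg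
  rw [pointReflection_zero hR] at hlim2
  refine tendsto_nhds_unique hlim1 (hlim2.congr' ?_)
  filter_upwards [eventually_gt_atTop 0] with n hn
  exact (integral_laplaceBeltrami_mul_cutoffProfile hR P hF hFc (by exact_mod_cast hn)).symm

/-- By `Γ(d/2 + 1) = (d/2) Γ(d/2)`, `d` times the volume of the unit ball is the sphere area `2
π^(d/2) / Γ(d/2)`. -/
theorem greenConstant_mul_mass (hd : 2 ≤ d) (hR : 0 < R) :
    Real.Gamma ((d : ℝ) / 2) / (2 * Real.pi ^ ((d : ℝ) / 2) * R ^ (d - 2)) *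
      (d * volume.real (Metric.ball (0 : EuclideanSpace ℝ (Fin d)) 1) * R ^ (d - 2)) = 1 := by
  have : Nonempty (Fin d) := ⟨⟨0, by omega⟩⟩
  have hd0 : (0 : ℝ) < (d : ℝ) / 2 := by
    have : (0 : ℝ) < d := by exact_mod_cast (by omega : 0 < d)
    positivity
  have hG : 0 < Real.Gamma ((d : ℝ) / 2) := Real.Gamma_pos_of_pos hd0
  have hG2 := Real.Gamma_add_one hd0.ne'
  rw [Measure.real, EuclideanSpace.volume_ball, Fintype.card_fin, hG2]
  have hp : Real.sqrt Real.pi ^ d = Real.pi ^ ((d : ℝ) / 2) := by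
    rw [Real.sqrt_eq_rpow, ← Real.rpow_mul_natCast Real.pi_pos.le]
    congr 1
    ring
  have hpp : 0 < Real.pi ^ ((d : ℝ) / 2) := Real.rpow_pos_of_pos Real.pi_pos _
  rw [hp, ENNReal.ofReal_one, one_pow, one_mul, ENNReal.toReal_ofReal (by positivity)]
  have : (d : ℝ) ≠ 0 := by intro h; simp [h] at hd0
  field_simp

theorem hyperboloidVolume_eq (hR : 0 < R) :
    hyperboloidVolume d hR = Measure.map (hyperboloidChart d hR).symm
      (coordVolume R (EuclideanSpace ℝ (Fin d))) := by
  rw [hyperboloidVolume, coordVolume]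
  simp only [sqrt_abs_det_hyperboloidMetric hR]

theorem minkowski_comm (x y : Fin (d + 1) → ℝ) : minkowski x y = minkowski y x := by
  simp [minkowski, mul_comm]

theorem minkowski_smul_hyperboloidParam (P ξ : EuclideanSpace ℝ (Fin d)) :
    minkowski (R⁻¹ • hyperboloidParam R P) (R⁻¹ • hyperboloidParam R ξ) = coshDist R P ξ := by
  simp only [minkowski, Pi.smul_apply, smul_eq_mul, hyperboloidParam_zero, hyperboloidParam_succ,
    coshDist, inner_eq_sum]
  rw [sub_div, Finset.sum_div]
  congr 1
  · ring
  · exact Finset.sum_congr rfl fun i _ => by ring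

theorem hyperboloidGreen_comm (x y : hyperboloid d R) :
    hyperboloidGreen d R x y = hyperboloidGreen d R y x := by
  simp only [hyperboloidGreen, unitGeodesicDist, minkowski_comm]

theorem hyperboloidGreen_chart_symm (hR : 0 < R) (p : hyperboloid d R)
    (ξ : EuclideanSpace ℝ (Fin d)) :
    hyperboloidGreen d R p ((hyperboloidChart d hR).symm ξ) =
      Real.Gamma ((d : ℝ) / 2) / (2 * Real.pi ^ ((d : ℝ) / 2) * R ^ (d - 2)) *
        greenProfile d (coshDist R (hyperboloidChart d hR p) ξ) := by
  obtain ⟨P, rfl⟩ := (hyperboloidChart d hR).symm.surjective p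
  rw [Homeomorph.apply_symm_apply, hyperboloidGreen, greenProfile, unitGeodesicDist,
    ← minkowski_smul_hyperboloidParam]
  rfl

theorem solvesDirac_hyperboloidGreen (hd : 2 ≤ d) (hR : 0 < R) (p : hyperboloid d R) :
    SolvesDirac d hR p (fun y => hyperboloidGreen d R p y) := by
  set c := Real.Gamma ((d : ℝ) / 2) / (2 * Real.pi ^ ((d : ℝ) / 2) * R ^ (d - 2)) with hc
  set P := hyperboloidChart d hR p with hP
  have hF : ∀ f : hyperboloid d R → ℝ, IsTestFunction d hR f →
      HasCompactSupport (f ∘ (hyperboloidChart d hR).symm) := fun f hf =>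
    hf.compactSupport.comp_homeomorph _
  have hcomp : ∀ f : hyperboloid d R → ℝ,
      (fun y => -hyperboloidLaplacian d hR f y * hyperboloidGreen d R p y) ∘
        (hyperboloidChart d hR).symm = fun ξ => -c * (laplaceBeltrami (hyperboloidMetric R)
          (f ∘ (hyperboloidChart d hR).symm) ξ * greenProfile d (coshDist R P ξ)) := fun f => by
    ext ξ
    simp only [Function.comp_apply, hyperboloidLaplacian, Homeomorph.apply_symm_apply,
      hyperboloidGreen_chart_symm hR, ← hc, ← hP]
    ring
  refine ⟨?_, fun f hf => ?_, fun f hf => ?_⟩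
  · rw [hyperboloidVolume_eq, locallyIntegrable_map_homeomorph]
    refine ((locallyIntegrable_greenProfile hd hR P).smul c).congr (.of_forall fun ξ => ?_)
    simp only [Function.comp_apply, hyperboloidGreen_chart_symm hR, Pi.smul_apply, smul_eq_mul,
      ← hc, ← hP]
  · rw [hyperboloidVolume_eq,
      (hyperboloidChart d hR).symm.measurableEmbedding.integrable_map_iff, hcomp]
    exact (integrable_laplaceBeltrami_mul_greenProfile hd hR P hf.smooth (hF f hf)).const_mul _
  · rw [hyperboloidVolume_eq, (hyperboloidChart d hR).symm.measurableEmbedding.integral_map]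
    refine (integral_congr_ae (.of_forall fun ξ => congrFun (hcomp f) ξ)).trans ?_
    rw [integral_const_mul,
      integral_laplaceBeltrami_mul_greenProfile hd hR P hf.smooth (hF f hf)]
    have h1 := greenConstant_mul_mass hd hR
    rw [← hc] at h1
    rw [Function.comp_apply, hP, Homeomorph.symm_apply_apply]
    linear_combination f p * h1

theorem isFundamentalSolution_hyperboloidGreen (hd : 2 ≤ d) (hR : 0 < R) :
    IsFundamentalSolution d hR (hyperboloidGreen d R) := fun p => by
  refine ⟨solvesDirac_hyperboloidGreen hd hR p, ?_⟩
  simp only [hyperboloidGreen_comm _ p]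
  exact solvesDirac_hyperboloidGreen hd hR p

end FundamentalSolution

end HyperbolicGreen

/-- Natural-number subtraction and division below are exact in the stated ranges, except that
`(-1)‼ = 1` is rendered as `0‼ = 1`: `(d - 3)‼` at `d = 2` and `(2 * k - 3)‼` at `k = 1`. -/
theorem theorem1 (d : ℕ) (hd : 2 ≤ d) (R : ℝ) (hR : 0 < R) :
    IsFundamentalSolution d hR (hyperboloidGreen d R) ∧
    ∀ ρ : ℝ, 0 < ρ →
      IntegrableOn (fun x => 1 / Real.sinh x ^ (d - 1)) (Set.Ioi ρ) ∧
      (Even d →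
        hypIntegral d ρ =
          (-1) ^ (d / 2 - 1) * (((d - 3)‼ : ℝ) / ((d - 2)‼ : ℝ)) *
            (Real.log (Real.cosh (ρ / 2) / Real.sinh (ρ / 2)) +
              Real.cosh ρ * ∑ k ∈ Finset.Icc 1 (d / 2 - 1),
                ((2 * k - 2)‼ : ℝ) * (-1) ^ k /
                  (((2 * k - 1)‼ : ℝ) * Real.sinh ρ ^ (2 * k)))) ∧
      (Odd d →
        hypIntegral d ρ =
          (-1) ^ ((d - 1) / 2) * (((d - 3)‼ : ℝ) / ((d - 2)‼ : ℝ) +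
            (((d - 3) / 2)! : ℝ) * ∑ k ∈ Finset.Icc 1 ((d - 1) / 2),
              (-1) ^ k * (Real.cosh ρ / Real.sinh ρ) ^ (2 * k - 1) /
                ((2 * (k : ℝ) - 1) * ((k - 1)! : ℝ) * (((d - 2 * k - 1) / 2)! : ℝ))) ∧
        hypIntegral d ρ =
          (-1) ^ ((d - 1) / 2) * (((d - 3)‼ : ℝ) / ((d - 2)‼ : ℝ)) *
            (1 + Real.cosh ρ * ∑ k ∈ Finset.Icc 1 ((d - 1) / 2),
              ((2 * k - 3)‼ : ℝ) * (-1) ^ k /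
                (((2 * k - 2)‼ : ℝ) * Real.sinh ρ ^ (2 * k - 1)))) ∧
      hypIntegral d ρ =
        1 / (((d : ℝ) - 1) * Real.cosh ρ ^ (d - 1)) *
          ₂F₁ (((d : ℝ) - 1) / 2) ((d : ℝ) / 2) (((d : ℝ) + 1) / 2) (1 / Real.cosh ρ ^ 2) ∧
      hypIntegral d ρ =
        1 / (((d : ℝ) - 1) * Real.cosh ρ * Real.sinh ρ ^ (d - 2)) *
          ₂F₁ (1 / 2 : ℝ) 1 (((d : ℝ) + 1) / 2) (1 / Real.cosh ρ ^ 2) ∧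
      (hypIntegral d ρ : ℂ) =
        Complex.exp (-(Complex.I * Real.pi * ((d : ℂ) / 2 - 1))) /
            ((2 : ℂ) ^ ((d : ℂ) / 2 - 1) * Complex.Gamma ((d : ℂ) / 2) *
              (Real.sinh ρ : ℂ) ^ ((d : ℂ) / 2 - 1)) *
          legendreQ ((d : ℂ) / 2 - 1) ((d : ℂ) / 2 - 1) (Real.cosh ρ) := by
  refine ⟨HyperbolicGreen.isFundamentalSolution_hyperboloidGreen hd hR, fun ρ hρ =>
    ⟨HyperbolicGreen.integrableOn_one_div_sinh_pow (by omega) hρ, ?_, ?_,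
      HyperbolicGreen.hypIntegral_eq_hypergeometric hd hρ,
      HyperbolicGreen.hypIntegral_eq_hypergeometric_half_one hd hρ,
      HyperbolicGreen.hypIntegral_eq_legendreQ hd hρ⟩⟩
  · rintro ⟨k, rfl⟩
    obtain ⟨m, rfl⟩ := Nat.exists_eq_add_of_le' (show 1 ≤ k by omega)
    -- At `m = 0` both `2 * m + 2 - 3` and `2 * m - 1` truncate to `0`, so the conventions for
    -- `(-1)!!` agree.
    rw [show m + 1 + (m + 1) = 2 * m + 2 by ring, HyperbolicGreen.hypIntegral_even m hρ,
      show (2 * m + 2) / 2 - 1 = m by omega, show 2 * m + 2 - 3 = 2 * m - 1 by omega,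
      show 2 * m + 2 - 2 = 2 * m by omega]
  · rintro ⟨k, rfl⟩
    obtain ⟨m, rfl⟩ := Nat.exists_eq_add_of_le' (show 1 ≤ k by omega)
    rw [show 2 * (m + 1) + 1 = 2 * m + 3 by ring, show (2 * m + 3 - 1) / 2 = m + 1 by omega,
      show 2 * m + 3 - 3 = 2 * m by omega, show 2 * m + 3 - 2 = 2 * m + 1 by omega,
      show 2 * m / 2 = m by omega]
    refine ⟨?_, HyperbolicGreen.hypIntegral_odd m hρ⟩
    rw [HyperbolicGreen.hypIntegral_odd_coth m hρ]
    congr 3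
    refine Finset.sum_congr rfl fun k _ => ?_
    rw [show (2 * m + 3 - 2 * k - 1) / 2 = m + 1 - k by omega]
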